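/- Identify $\mathbb{R}^4$ with $\mathbb{R}^2(x)\times\mathbb{R}^2(y)$, with its standard inner product, and let $J=\begin{pmatrix}0&\mathbb{1}\\-\mathbb{1}&0\end{pmatrix}$. For a compact convex set $C\subset\mathbb{R}^4$ with the origin in its interior let $\mu_C(z)=\min\{t\ge 0: z\in tC\}$ be its Minkowski functional and $\partial\mu_C$ the subdifferential of $\mu_C$. A closed characteristic on $\partial C$ is an absolutely continuous loop $x:\mathbb{R}/\mathbb{Z}\to\mathbb{R}^4$ with $\mu_C(x(t))=1$ for all $t$ and $\dot x(t)\in (0,\infty)\,J\,\partial\mu_C(x(t))$ for almost every $t$; its action is $\mathbb{A}(x)=-\frac12\int_{\mathbb{R}/\mathbb{Z}}\langle J\dot x(t),x(t)\rangle\,dt$. The EHZ-capacity of $C$ is $$c_{EHZ}(C)=\min\{\mathbb{A}(x): x\text{ a closed characteristic on }\partial C\}.$$ For a compact convex set with nonempty interior that does not contain the origin in its interior, the capacity is that of any translate that does. A trapezoid is the closed region bounded by a nondegenerate convex quadrilateral with at least one pair of parallel sides (parallelograms included); nondegenerate triangles are included as degenerate trapezoids. Theorem. Let $Q\subset\mathbb{R}^2$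 be any trapezoid and $T\subset\mathbb{R}^2$ any convex body (compact convex set with nonempty interior). Then, for every translate of $Q\times T$ with the origin in its interior, the minimum defining its EHZ-capacity is attained, and $$\mathrm{vol}(Q\times T)\ \ge\ \frac{c_{EHZ}(Q\times T)^2}{2},$$ where $c_{EHZ}(Q\times T)$ is the capacity of any such translate. -/

import Mathlib

open Set MeasureTheory

/-- The Euclidean plane. -/
abbrev Plane : Type := EuclideanSpace ℝ (Fin 2)

/-- The phase space `ℝ⁴ = ℝ²(x) × ℝ²(y)`, with the product Lebesgue measure. -/
abbrev PhaseSpace : Type := Plane × Plane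

/-- The standard inner product of `ℝ⁴` (the instance norm on a product is the sup norm, so it is
written out). -/
noncomputable def phaseInner (z w : PhaseSpace) : ℝ :=
  inner ℝ z.1 w.1 + inner ℝ z.2 w.2

/-- The symplectic matrix with block rows `(0, 1)` and `(-1, 0)`: `J (x, y) = (y, -x)`. -/
def sympJ (z : PhaseSpace) : PhaseSpace := (z.2, -z.1)

/-- The subdifferential at `z` of a real-valued function on `ℝ⁴`. -/
def subdifferential (f : PhaseSpace → ℝ) (z : PhaseSpace) : Set PhaseSpace :=
  {w | ∀ y, f z + phaseInner w (y - z) ≤ f y}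

/-- Closed characteristics on the boundary of `C`, where `C` is a compact convex set with the
origin in its interior; `gauge C` is the Minkowski functional of `C`. The circle `ℝ/ℤ` is
represented by `[0, 1]` with its end points identified. The factor `r` is strictly positive, so
that constant loops are not closed characteristics. -/
structure IsClosedCharacteristic (C : Set PhaseSpace) (x : ℝ → PhaseSpace) : Prop where
  absolutelyContinuous : AbsolutelyContinuousOnInterval x 0 1
  closed : x 0 = x 1
  gauge_eq_one : ∀ t ∈ Icc (0 : ℝ) 1, gauge C (x t) = 1
  velocity : ∀ᵐ t ∂(volume.restrict (Icc (0 : ℝ) 1)),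
    ∃ r : ℝ, 0 < r ∧ ∃ w ∈ subdifferential (gauge C) (x t), HasDerivAt x (r • sympJ w) t

/-- The action `-(1/2) ∫ ⟨J ẋ(t), x(t)⟩ dt` of a loop. -/
noncomputable def loopAction (x : ℝ → PhaseSpace) : ℝ :=
  -(1 / 2) * ∫ t in (0 : ℝ)..1, phaseInner (sympJ (deriv x t)) (x t)

/-- The set of actions of the closed characteristics on the boundary of `C`. -/
def actionSpectrum (C : Set PhaseSpace) : Set ℝ :=
  {a | ∃ x : ℝ → PhaseSpace, IsClosedCharacteristic C x ∧ loopAction x = a}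

/-- The EHZ-capacity of `C`: the minimal action of a closed characteristic on the boundary.
That the infimum is a minimum is to be asserted by `IsLeast (actionSpectrum C) (cEHZ C)`. -/
noncomputable def cEHZ (C : Set PhaseSpace) : ℝ := sInf (actionSpectrum C)

/-- Convex bodies of the plane. -/
structure IsConvexBody (T : Set Plane) : Prop where
  isCompact : IsCompact T
  convex : Convex ℝ T
  interior_nonempty : (interior T).Nonempty

/-- (Solid) trapezoids `a b c d`: the side from `d` to `c` is parallel to the side from `a` to `b`,
and `a`, `b`, `d` are not collinear. Parallelograms (`r = 1`) are included, and so are triangles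
(`r = 0`, that is, `c = d`). -/
def IsTrapezoid (Q : Set Plane) : Prop :=
  ∃ a b c d : Plane, AffineIndependent ℝ ![a, b, d] ∧
    (∃ r : ℝ, 0 ≤ r ∧ c - d = r • (b - a)) ∧ Q = convexHull ℝ {a, b, c, d}

/-! In suitable linear coordinates the trapezoid is `frameRegion a e' f' k` with `0 ≤ k ≤ 1`, and
its sides have outer normals `f'`, `-f'`, `-e'` and `e' + k • f'`. Three cyclic triples of multiples
of these normals sum to zero: `chordNormals`, `triangleNormals` and `oppositeNormals`. For such a
triple `d` let `s(d)` be the largest factor for which `T` contains a closed triangle with edges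
`s(d) • d j`. The capacity is the minimum `c` of the three values `s(d)`.

Lower bound: the position curve of a closed characteristic of action `A` has `T`-length `A`, so
every triangle inscribed in it has `T`-length at most `A` (`sum_inner_le_loopAction`). Testing with
the triangles in `T` bounds the widths of the curve, which therefore fits, after translation, into
`(A / c) • Q` (`BoundsTriangles.exists_translate`). It fits into no copy of `Q` of factor below `1`
(`one_le_of_translate_mem_smul`), hence `A ≥ c`.

Attainment: at the maximal triangle for `d`, a supporting functional is a second triangle `q` whose
edges are normal to `T` at the vertices of the first (`exists_dual_triangles`). If `s(d) = c`, the
same translation argument puts `q` inside `Q`, and equality in the width estimates puts its vertices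
on the sides with normals `d j`. The two triangles together form a closed characteristic of action
`c` (`mem_actionSpectrum_of_dual`).

Volume: the triangles of size `c` in `T` force its area, in the dual coordinates, to be at least `c
^ 2 / (2 - k)` (`volume_ge_of_triangles`), while `Q` has area at least `(2 - k) / 2`. The coordinate
determinants cancel in the product. -/

/-! ### Subgradients of the gauge -/

lemma phaseInner_self_of_mem_subdifferential {C : Set PhaseSpace} {z w : PhaseSpace}
    (hw : w ∈ subdifferential (gauge C) z) : phaseInner w z = gauge C z := by
  -- Euler's identity for a positively homogeneous function: the points `0` and `2 • z` give the two
  -- opposite inequalities.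
  have h0 := hw 0
  have h2 := hw ((2 : ℝ) • z)
  rw [gauge_smul_of_nonneg (by norm_num)] at h2
  simp only [phaseInner, gauge_zero, smul_eq_mul, Prod.fst_sub, Prod.snd_sub, Prod.fst_zero,
    Prod.snd_zero, Prod.smul_fst, Prod.smul_snd, inner_sub_right, inner_smul_right,
    inner_zero_right] at *
  linarith

lemma phaseInner_le_of_mem_subdifferential {C : Set PhaseSpace} {z w y : PhaseSpace}
    (hw : w ∈ subdifferential (gauge C) z) (hz : gauge C z = 1) (hy : y ∈ C) :
    phaseInner w y ≤ phaseInner w z := by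
  have h := hw y
  have h1 := gauge_le_one_of_mem hy
  simp only [phaseInner, Prod.fst_sub, Prod.snd_sub, inner_sub_right] at *
  linarith

lemma phaseInner_le_gauge {C : Set PhaseSpace} (hC : C ∈ nhds (0 : PhaseSpace)) {w : PhaseSpace}
    (hw : ∀ y ∈ C, phaseInner w y ≤ 1) (y : PhaseSpace) : phaseInner w y ≤ gauge C y := by
  refine le_csInf (absorbent_nhds_zero hC).gauge_set_nonempty ?_
  rintro r ⟨hr, u, hu, rfl⟩
  have := mul_le_mul_of_nonneg_left (hw u hu) (le_of_lt hr)
  simp only [phaseInner, Prod.smul_fst, Prod.smul_snd, inner_smul_right] at *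
  linarith

/-- A polar vector that attains its maximum `1` at a point of `C` certifies both that the point is
on the boundary and that the vector is a subgradient there. -/
lemma gauge_eq_one_and_mem_subdifferential {C : Set PhaseSpace} (hC : C ∈ nhds (0 : PhaseSpace))
    {w z : PhaseSpace} (hw : ∀ y ∈ C, phaseInner w y ≤ 1) (hz : z ∈ C)
    (hwz : phaseInner w z = 1) : gauge C z = 1 ∧ w ∈ subdifferential (gauge C) z := by
  have h1 : gauge C z = 1 :=
    le_antisymm (gauge_le_one_of_mem hz) (hwz ▸ phaseInner_le_gauge hC hw z)
  refine ⟨h1, fun y => ?_⟩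
  have := phaseInner_le_gauge hC hw y
  simp only [phaseInner, Prod.fst_sub, Prod.snd_sub, inner_sub_right] at *
  linarith

/-! ### Polygonal closed characteristics -/

/-- A Lipschitz path on the boundary of `C` from `z` to `z'` that follows the characteristic
direction with unit factor for the time `ℓ`, with finitely many corners. -/
def HasCharPath (C : Set PhaseSpace) (ℓ : ℝ) (z z' : PhaseSpace) : Prop :=
  0 ≤ ℓ ∧ ∃ (x : ℝ → PhaseSpace) (K : NNReal), LipschitzWith K x ∧ x 0 = z ∧ x ℓ = z' ∧
    (0 < ℓ → ∀ t ∈ Icc 0 ℓ, gauge C (x t) = 1) ∧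
    ∃ S : Set ℝ, S.Finite ∧ ∀ t ∈ Ioo 0 ℓ \ S,
      ∃ w ∈ subdifferential (gauge C) (x t), HasDerivAt x (sympJ w) t

lemma HasCharPath.refl (C : Set PhaseSpace) (z : PhaseSpace) : HasCharPath C 0 z z :=
  ⟨le_rfl, fun _ => z, 0, LipschitzWith.const z, rfl, rfl, fun h => absurd h (lt_irrefl _),
    ∅, finite_empty, fun _ ht => absurd (ht.1.1.trans ht.1.2) (lt_irrefl _)⟩

lemma HasCharPath.trans {C : Set PhaseSpace} {ℓ₁ ℓ₂ : ℝ} {z₁ z₂ z₃ : PhaseSpace}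
    (h₁ : HasCharPath C ℓ₁ z₁ z₂) (h₂ : HasCharPath C ℓ₂ z₂ z₃) :
    HasCharPath C (ℓ₁ + ℓ₂) z₁ z₃ := by
  obtain ⟨hℓ₁, x, K, hK, hx0, hxℓ, hxg, S, hS, hxd⟩ := h₁
  obtain ⟨hℓ₂, y, L, hL, hy0, hyℓ, hyg, R, hR, hyd⟩ := h₂
  -- Clamping the times makes the concatenation a sum of globally Lipschitz maps.
  set u : ℝ → PhaseSpace := fun t => x (min t ℓ₁) + (y (max (t - ℓ₁) 0) - z₂) with hu
  have hul : ∀ t, t ≤ ℓ₁ → u t = x t := fun t ht => by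
    simp [hu, min_eq_left ht, max_eq_right (sub_nonpos.2 ht), hy0]
  have hur : ∀ t, ℓ₁ ≤ t → u t = y (t - ℓ₁) := fun t ht => by
    simp [hu, min_eq_right ht, max_eq_left (sub_nonneg.2 ht), hxℓ]
  refine ⟨by linarith, u, K * 1 + (L * 1 + 0), ?_, ?_, ?_, ?_,
    insert ℓ₁ (S ∪ (fun t => t + ℓ₁) '' R), (hS.union (hR.image _)).insert _, ?_⟩
  · have e1 : LipschitzWith 1 (fun t : ℝ => min t ℓ₁) := LipschitzWith.id.min_const ℓ₁
    have e2 : LipschitzWith 1 (fun t : ℝ => max (t - ℓ₁) 0) := by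
      have : LipschitzWith 1 (fun t : ℝ => t - ℓ₁) :=
        LipschitzWith.of_dist_le_mul fun a b => by simp
      exact this.max_const 0
    exact (hK.comp e1).add ((hL.comp e2).sub (LipschitzWith.const z₂))
  · rw [hul 0 hℓ₁, hx0]
  · rw [hur _ (by linarith), add_sub_cancel_left, hyℓ]
  · intro h t ht
    rcases le_or_gt t ℓ₁ with h1 | h1
    · rcases hℓ₁.lt_or_eq with h0 | h0
      · rw [hul t h1]; exact hxg h0 t ⟨ht.1, h1⟩
      · have : t = ℓ₁ := le_antisymm h1 (h0 ▸ ht.1)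
        rw [hur t this.ge]
        exact hyg (by linarith) _ ⟨by linarith, by linarith⟩
    · rw [hur t h1.le]
      exact hyg (by linarith [ht.2]) _ ⟨by linarith, by linarith [ht.2]⟩
  · rintro t ⟨ht, htS⟩
    simp only [mem_insert_iff, mem_union, mem_image, not_or, not_exists, not_and] at htS
    rcases lt_or_gt_of_ne htS.1 with h1 | h1
    · obtain ⟨w, hw, hd⟩ := hxd t ⟨⟨ht.1, h1⟩, htS.2.1⟩
      refine ⟨w, by rwa [hul t h1.le], hd.congr_of_eventuallyEq ?_⟩
      filter_upwards [Iio_mem_nhds h1] with a ha using hul a (le_of_lt ha)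
    · obtain ⟨w, hw, hd⟩ := hyd (t - ℓ₁) ⟨⟨by linarith, by linarith [ht.2]⟩,
        fun h => htS.2.2 _ h (by ring)⟩
      refine ⟨w, by rwa [hur t h1.le], ?_⟩
      have hd' : HasDerivAt (fun s => y (s - ℓ₁)) (sympJ w) t := hd.comp_sub_const t ℓ₁
      refine hd'.congr_of_eventuallyEq ?_
      filter_upwards [Ioi_mem_nhds h1] with a ha using hur a (le_of_lt ha)

lemma hasCharPath_segment {C : Set PhaseSpace} (hC : C ∈ nhds (0 : PhaseSpace))
    (hconv : Convex ℝ C) {ℓ : ℝ} (hℓ : 0 < ℓ) {z z' w : PhaseSpace} (hz : z ∈ C) (hz' : z' ∈ C)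
    (hzz' : z' = z + ℓ • sympJ w) (hw : ∀ y ∈ C, phaseInner w y ≤ 1) (hwz : phaseInner w z = 1) :
    HasCharPath C ℓ z z' := by
  -- Since `sympJ w` is orthogonal to `w`, the functional `w` stays at its maximum along the
  -- segment.
  have hJ : phaseInner w (sympJ w) = 0 := by
    simp [phaseInner, sympJ, real_inner_comm]
  have key : ∀ t ∈ Icc 0 ℓ, gauge C (z + t • sympJ w) = 1 ∧
      w ∈ subdifferential (gauge C) (z + t • sympJ w) := by
    intro t ht
    refine gauge_eq_one_and_mem_subdifferential hC hw ?_ ?_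
    · have : z + t • sympJ w = z + (t / ℓ) • (z' - z) := by
        rw [hzz', add_sub_cancel_left, smul_smul, div_mul_cancel₀ _ hℓ.ne']
      rw [this]
      exact hconv.add_smul_sub_mem hz hz' ⟨by have := ht.1; positivity, (div_le_one hℓ).2 ht.2⟩
    · simp only [phaseInner, Prod.fst_add, Prod.snd_add, Prod.smul_fst, Prod.smul_snd,
        inner_add_right, inner_smul_right] at *
      linear_combination hwz + t * hJ
  refine ⟨hℓ.le, fun t => z + t • sympJ w, ‖sympJ w‖₊, ?_, by simp, hzz'.symm,
    fun _ t ht => (key t ht).1, ∅, finite_empty, fun t ht =>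
      ⟨w, (key t ⟨ht.1.1.le, ht.1.2.le⟩).2, ?_⟩⟩
  · refine LipschitzWith.of_dist_le_mul fun a b => ?_
    rw [dist_add_left, dist_eq_norm, ← sub_smul, norm_smul, dist_eq_norm, mul_comm]; rfl
  · simpa using ((hasDerivAt_id t).smul_const (sympJ w)).const_add z

/-- A linear functional that is nonpositive on a neighbourhood of the origin vanishes. -/
lemma eq_zero_of_forall_inner_le {E : Type*} [NormedAddCommGroup E] [InnerProductSpace ℝ E]
    {S : Set E} (hS : S ∈ nhds (0 : E)) {v : E} (h : ∀ y ∈ S, inner ℝ v y ≤ 0) : v = 0 := by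
  have ht : Filter.Tendsto (fun t : ℝ => t • v) (nhdsWithin 0 (Ioi 0)) (nhds 0) := by
    have : Continuous fun t : ℝ => t • v := by fun_prop
    simpa using (this.tendsto 0).mono_left nhdsWithin_le_nhds
  obtain ⟨t, h1, h2⟩ := ((ht.eventually_mem hS).and (eventually_mem_nhdsWithin)).exists
  have := h _ h1
  rw [inner_smul_right, real_inner_self_eq_norm_sq] at this
  have h3 : ‖v‖ ^ 2 ≤ 0 := by
    by_contra hcon
    exact absurd this (not_le.2 (mul_pos h2 (not_le.1 hcon)))
  exact norm_eq_zero.1 (pow_eq_zero_iff (two_ne_zero) |>.1 (le_antisymm h3 (by positivity)))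

/-- While the momentum rests at a point of `B` with normal `q' - q`, the position runs from `q` to
`q'`. Normalizing the subgradient to pair to `1` with the point makes the time equal to the
`B`-length of the edge; an edge of length zero is constant. -/
lemma hasCharPath_fst {A B : Set Plane} (hA : A ∈ nhds (0 : Plane)) (hB : B ∈ nhds (0 : Plane))
    (hA' : Convex ℝ A) (hB' : Convex ℝ B) {q q' p : Plane} (hq : q ∈ A) (hq' : q' ∈ A)
    (hp : p ∈ B) (h : ∀ y ∈ B, inner ℝ (q' - q) y ≤ inner ℝ (q' - q) p) :
    HasCharPath (A ×ˢ B) (inner ℝ (q' - q) p) (q, p) (q', p) := by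
  have h0 := h 0 (mem_of_mem_nhds hB)
  rw [inner_zero_right] at h0
  rcases h0.eq_or_lt with h0 | h0
  · have : q' - q = 0 := eq_zero_of_forall_inner_le hB fun y hy => (h y hy).trans h0.symm.le
    rw [← h0, sub_eq_zero.1 this]
    exact HasCharPath.refl _ _
  · refine hasCharPath_segment (w := (0, (inner ℝ (q' - q) p)⁻¹ • (q' - q)))
      (prod_mem_nhds hA hB) (hA'.prod hB') h0 ⟨hq, hp⟩ ⟨hq', hp⟩ ?_ ?_ ?_
    · simp [sympJ, smul_smul, h0.ne']
    · rintro ⟨y₁, y₂⟩ ⟨-, hy⟩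
      simp only [phaseInner, inner_zero_left, zero_add, real_inner_smul_left]
      rw [inv_mul_le_one₀ h0]
      exact h _ hy
    · simp [phaseInner, real_inner_smul_left, h0.ne']

lemma hasCharPath_snd {A B : Set Plane} (hA : A ∈ nhds (0 : Plane)) (hB : B ∈ nhds (0 : Plane))
    (hA' : Convex ℝ A) (hB' : Convex ℝ B) {q p p' : Plane} (hq : q ∈ A) (hp : p ∈ B)
    (hp' : p' ∈ B) (h : ∀ y ∈ A, inner ℝ (p - p') y ≤ inner ℝ (p - p') q) :
    HasCharPath (A ×ˢ B) (inner ℝ (p - p') q) (q, p) (q, p') := by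
  have h0 := h 0 (mem_of_mem_nhds hA)
  rw [inner_zero_right] at h0
  rcases h0.eq_or_lt with h0 | h0
  · have : p - p' = 0 := eq_zero_of_forall_inner_le hA fun y hy => (h y hy).trans h0.symm.le
    rw [← h0, sub_eq_zero.1 this]
    exact HasCharPath.refl _ _
  · refine hasCharPath_segment (w := ((inner ℝ (p - p') q)⁻¹ • (p - p'), 0))
      (prod_mem_nhds hA hB) (hA'.prod hB') h0 ⟨hq, hp⟩ ⟨hq, hp'⟩ ?_ ?_ ?_
    · simp [sympJ, smul_smul, h0.ne']
    · rintro ⟨y₁, y₂⟩ ⟨hy, -⟩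
      simp only [phaseInner, inner_zero_left, add_zero, real_inner_smul_left]
      rw [inv_mul_le_one₀ h0]
      exact h _ hy
    · simp [phaseInner, real_inner_smul_left, h0.ne']

/-- The subgradient pairs to `1` with the point, so after rescaling time to `[0, 1]` the action
integrand is the constant `-ℓ`. -/
lemma HasCharPath.mem_actionSpectrum {C : Set PhaseSpace} {ℓ : ℝ} {z : PhaseSpace}
    (hℓ : 0 < ℓ) (h : HasCharPath C ℓ z z) : ℓ / 2 ∈ actionSpectrum C := by
  obtain ⟨-, x, K, hK, hx0, hxℓ, hxg, S, hS, hxd⟩ := h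
  have hmem : ∀ t ∈ Icc (0 : ℝ) 1, ℓ * t ∈ Icc 0 ℓ := fun t ht =>
    ⟨mul_nonneg hℓ.le ht.1, by nlinarith [ht.2]⟩
  have hd : ∀ t ∈ Ioo (0 : ℝ) 1, ℓ * t ∉ S → ∃ w ∈ subdifferential (gauge C) (x (ℓ * t)),
      HasDerivAt (fun s => x (ℓ * s)) (ℓ • sympJ w) t := by
    intro t ht hS
    obtain ⟨w, hw, hd⟩ := hxd (ℓ * t) ⟨⟨mul_pos hℓ ht.1, by nlinarith [ht.2]⟩, hS⟩
    refine ⟨w, hw, ?_⟩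
    have h1 : HasDerivAt (fun s : ℝ => ℓ * s) ℓ t := by simpa using (hasDerivAt_id t).const_mul ℓ
    exact hd.scomp t h1
  have hfin : ((fun t => ℓ * t) ⁻¹' S ∪ {0, 1}).Finite :=
    (hS.preimage (mul_right_injective₀ hℓ.ne').injOn).union (by simp)
  have hae : ∀ᵐ t ∂(volume : Measure ℝ), t ∈ Icc (0 : ℝ) 1 →
      ∃ w ∈ subdifferential (gauge C) (x (ℓ * t)),
        HasDerivAt (fun s => x (ℓ * s)) (ℓ • sympJ w) t := by
    filter_upwards [hfin.countable.ae_notMem volume] with t ht ht01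
    simp only [mem_union, mem_preimage, mem_insert_iff, mem_singleton_iff, not_or] at ht
    exact hd t ⟨lt_of_le_of_ne ht01.1 (Ne.symm ht.2.1), lt_of_le_of_ne ht01.2 ht.2.2⟩ ht.1
  refine ⟨fun t => x (ℓ * t), ⟨?_, by simp [hx0, hxℓ], fun t ht => hxg hℓ _ (hmem t ht), ?_⟩, ?_⟩
  · have : LipschitzWith ‖ℓ‖₊ (fun t : ℝ => ℓ * t) :=
      LipschitzWith.of_dist_le_mul fun a b => by
        rw [dist_eq_norm, ← mul_sub, norm_mul, dist_eq_norm]; rfl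
    exact ((hK.comp this).lipschitzOnWith (s := uIcc 0 1)).absolutelyContinuousOnInterval
  · rw [ae_restrict_iff' measurableSet_Icc]
    filter_upwards [hae] with t ht ht01
    obtain ⟨w, hw, hd⟩ := ht ht01
    exact ⟨ℓ, hℓ, w, hw, hd⟩
  · have : ∫ t in (0 : ℝ)..1, phaseInner (sympJ (deriv (fun t => x (ℓ * t)) t)) (x (ℓ * t)) =
        ∫ t in (0 : ℝ)..1, -ℓ := by
      refine intervalIntegral.integral_congr_ae ?_
      filter_upwards [hae] with t ht ht01
      rw [uIoc_of_le zero_le_one] at ht01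
      obtain ⟨w, hw, hd⟩ := ht ⟨ht01.1.le, ht01.2⟩
      have h1 := phaseInner_self_of_mem_subdifferential hw
      rw [hxg hℓ _ (hmem t ⟨ht01.1.le, ht01.2⟩)] at h1
      rw [hd.deriv]
      simp only [phaseInner, sympJ, Prod.smul_mk, inner_neg_left, smul_neg,
        real_inner_smul_left] at *
      linear_combination -ℓ * h1
    rw [loopAction, this]
    simp
    ring

/-- A closed triangle `q` in `A` and a closed triangle `p` in `B` such that each edge of either is
normal to the other set at the matching vertex of the other give a closed characteristic. -/
lemma mem_actionSpectrum_of_triangles {A B : Set Plane} (hA : A ∈ nhds (0 : Plane))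
    (hB : B ∈ nhds (0 : Plane)) (hA' : Convex ℝ A) (hB' : Convex ℝ B) {q p : Fin 3 → Plane}
    (hq : ∀ j, q j ∈ A) (hp : ∀ j, p j ∈ B)
    (hqp : ∀ j, ∀ y ∈ B, inner ℝ (q (j + 1) - q j) y ≤ inner ℝ (q (j + 1) - q j) (p j))
    (hpq : ∀ j, ∀ y ∈ A, inner ℝ (p j - p (j + 1)) y ≤ inner ℝ (p j - p (j + 1)) (q (j + 1)))
    (hpos : 0 < ∑ j, inner ℝ (q (j + 1) - q j) (p j)) :
    ∑ j, inner ℝ (q (j + 1) - q j) (p j) ∈ actionSpectrum (A ×ˢ B) := by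
  have step : ∀ j, HasCharPath (A ×ˢ B)
      (inner ℝ (q (j + 1) - q j) (p j) + inner ℝ (p j - p (j + 1)) (q (j + 1)))
      (q j, p j) (q (j + 1), p (j + 1)) := fun j =>
    (hasCharPath_fst hA hB hA' hB' (hq _) (hq _) (hp j) (hqp j)).trans
      (hasCharPath_snd hA hB hA' hB' (hq _) (hp _) (hp _) (hpq j))
  have h := ((step 0).trans (step 1)).trans (step 2)
  simp only [Fin.sum_univ_three] at *
  simp only [Fin.isValue, zero_add, show (1 + 1 : Fin 3) = 2 from rfl,
    show (2 + 1 : Fin 3) = 0 from rfl] at *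
  -- Summation by parts: the position edges and the momentum edges take the same total time, which
  -- absorbs the factor `1 / 2` in the action.
  have e : inner ℝ (q 1 - q 0) (p 0) + inner ℝ (p 0 - p 1) (q 1) +
      (inner ℝ (q 2 - q 1) (p 1) + inner ℝ (p 1 - p 2) (q 2)) +
      (inner ℝ (q 0 - q 2) (p 2) + inner ℝ (p 2 - p 0) (q 0)) =
      2 * (inner ℝ (q 1 - q 0) (p 0) + inner ℝ (q 2 - q 1) (p 1) + inner ℝ (q 0 - q 2) (p 2)) := by
    simp only [inner_sub_left, real_inner_comm (q _) (p _)]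
    ring
  rw [e] at h
  have := h.mem_actionSpectrum (by linarith)
  rwa [mul_div_cancel_left₀ _ two_ne_zero] at this

/-! ### Maximal triangles and their duals -/

/-- The last point of a compact convex neighbourhood of the origin on a ray, with a supporting
functional there. -/
lemma exists_support_on_ray {E : Type*} [NormedAddCommGroup E] [NormedSpace ℝ E] {K : Set E}
    (hK : IsCompact K) (hconv : Convex ℝ K) (h0 : K ∈ nhds (0 : E)) {D : E} (hD : D ≠ 0) :
    ∃ s : ℝ, 0 < s ∧ s • D ∈ K ∧ ∃ f : E →L[ℝ] ℝ, f D = 1 ∧ ∀ x ∈ K, f x ≤ s := by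
  have hg : 0 < gauge K D :=
    (gauge_pos (absorbent_nhds_zero h0) (NormedSpace.isVonNBounded_iff ℝ |>.2 hK.isBounded)).2 hD
  have h1 : gauge K ((gauge K D)⁻¹ • D) = 1 := by
    rw [gauge_smul_of_nonneg (inv_nonneg.2 hg.le), smul_eq_mul, inv_mul_cancel₀ hg.ne']
  have hmem : (gauge K D)⁻¹ • D ∈ K := by
    have := (gauge_le_one_iff_mem_closure hconv h0).1 h1.le
    rwa [hK.isClosed.closure_eq] at this
  have hnot : (gauge K D)⁻¹ • D ∉ interior K := fun h =>
    absurd ((gauge_lt_one_iff_mem_interior hconv h0).2 h) (by rw [h1]; exact lt_irrefl _)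
  obtain ⟨f, hf⟩ := geometric_hahn_banach_open_point hconv.interior isOpen_interior hnot
  have hf0 : 0 < f D := by
    have := hf 0 (mem_interior_iff_mem_nhds.2 h0)
    rw [map_zero, map_smul, smul_eq_mul] at this
    exact pos_of_mul_pos_right this (inv_nonneg.2 hg.le)
  have hle : ∀ x ∈ K, f x ≤ (gauge K D)⁻¹ * f D := by
    intro x hx
    have hcl : x ∈ closure (interior K) := by
      rw [hconv.closure_interior_eq_closure_of_nonempty_interior ⟨0, mem_interior_iff_mem_nhds.2 h0⟩]
      exact subset_closure hx
    have : closure (interior K) ⊆ {x | f x ≤ (gauge K D)⁻¹ * f D} :=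
      closure_minimal (fun y hy => by simpa using (hf y hy).le)
        (isClosed_le f.continuous continuous_const)
    exact this hcl
  refine ⟨(gauge K D)⁻¹, inv_pos.2 hg, hmem, (f D)⁻¹ • f, by simp [hf0.ne'], fun x hx => ?_⟩
  have := hle x hx
  rw [smul_apply, smul_eq_mul, inv_mul_le_iff₀ hf0]
  linarith

/-- The largest triangle with edges proportional to `d` in `T`, together with the dual triangle. -/
lemma exists_dual_triangles {T : Set Plane} (hT : IsConvexBody T) {d : Fin 3 → Plane}
    (hsum : ∑ j, d j = 0) (hd : d ≠ 0) :
    ∃ s : ℝ, 0 < s ∧ ∃ p q : Fin 3 → Plane, (∀ j, p j ∈ T) ∧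
      (∀ j, p j - p (j + 1) = s • d (j + 1)) ∧ ∑ j, inner ℝ (d j) (q j) = 1 ∧
      ∀ j, ∀ y ∈ T, inner ℝ (q (j + 1) - q j) y ≤ inner ℝ (q (j + 1) - q j) (p j) := by
  -- Two edges determine a closed triangle up to translation, so the triangles in `T` become a
  -- convex body `K` of edge pairs, and the maximal one is the last point of `K` on the ray of `(d
  -- 0, d 1)`.
  let Φ : (Fin 3 → Plane) →L[ℝ] Plane × Plane :=
    ((ContinuousLinearMap.proj 2 : (Fin 3 → Plane) →L[ℝ] Plane) -
        ContinuousLinearMap.proj 0).prod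
      ((ContinuousLinearMap.proj 0 : (Fin 3 → Plane) →L[ℝ] Plane) - ContinuousLinearMap.proj 1)
  have hΦ : ∀ p, Φ p = (p 2 - p 0, p 0 - p 1) := fun p => rfl
  have hsurj : Function.Surjective Φ := fun ⟨u, v⟩ => ⟨![0, -v, u], by simp [hΦ]⟩
  set K : Set (Plane × Plane) := Φ '' (univ.pi fun _ => T) with hKdef
  have hK : IsCompact K := (isCompact_univ_pi fun _ => hT.isCompact).image Φ.continuous
  have hconv : Convex ℝ K := (convex_pi fun _ _ => hT.convex).linear_image Φ.toLinearMap
  -- `Φ` is open and kills constant triples, such as an interior point of `T` taken three times.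
  have h0 : K ∈ nhds (0 : Plane × Plane) := by
    obtain ⟨t, ht⟩ := hT.interior_nonempty
    have h1 : (univ.pi fun _ : Fin 3 => T) ∈ nhds (fun _ : Fin 3 => t) :=
      set_pi_mem_nhds finite_univ fun _ _ => mem_interior_iff_mem_nhds.1 ht
    have h2 := (Φ.isOpenMap hsurj).image_mem_nhds h1
    rwa [show Φ (fun _ => t) = 0 by simp [hΦ]] at h2
  rw [Fin.sum_univ_three] at hsum
  have hd2 : d 2 = -d 0 - d 1 := by
    rw [eq_sub_iff_add_eq, eq_neg_iff_add_eq_zero, ← hsum]; abel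
  have hD : (d 0, d 1) ≠ 0 := by
    intro h
    rw [Prod.mk_eq_zero] at h
    refine hd (funext fun j => ?_)
    fin_cases j
    · exact h.1
    · exact h.2
    · simp [hd2, h.1, h.2]
  obtain ⟨s, hs, ⟨p, hp, hpD⟩, f, hfD, hf⟩ := exists_support_on_ray hK hconv h0 hD
  rw [hΦ, Prod.smul_mk, Prod.mk.injEq] at hpD
  set u : Plane := (InnerProductSpace.toDual ℝ Plane).symm
    (f.comp (ContinuousLinearMap.inl ℝ Plane Plane)) with hu
  set v : Plane := (InnerProductSpace.toDual ℝ Plane).symm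
    (f.comp (ContinuousLinearMap.inr ℝ Plane Plane)) with hv
  have hfuv : ∀ x y, f (x, y) = inner ℝ u x + inner ℝ v y := by
    intro x y
    simp only [hu, hv, InnerProductSpace.toDual_symm_apply, ContinuousLinearMap.comp_apply,
      ContinuousLinearMap.inl_apply, ContinuousLinearMap.inr_apply, ← map_add, Prod.mk_add_mk,
      add_zero, zero_add]
  have hfp : f (p 2 - p 0, p 0 - p 1) = s := by
    rw [hpD.1, hpD.2, ← Prod.smul_mk, map_smul, hfD, smul_eq_mul, mul_one]
  -- Moving one vertex at a time splits the maximality of `p` into one normality condition per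
  -- vertex; the partial gradients are the edges of `q`.
  have hmax : ∀ j, ∀ y ∈ T, inner ℝ u (Function.update p j y 2 - Function.update p j y 0) +
      inner ℝ v (Function.update p j y 0 - Function.update p j y 1) ≤
      inner ℝ u (p 2 - p 0) + inner ℝ v (p 0 - p 1) := by
    intro j y hy
    rw [← hfuv, ← hfuv, hfp]
    refine hf _ ⟨Function.update p j y, fun i _ => ?_, hΦ _⟩
    rcases eq_or_ne i j with rfl | h
    · simpa using hy
    · simpa [h] using hp i (mem_univ _)
  -- Only the differences of `q` matter, because the `d j` sum to zero; the last vertex is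
  -- normalized to `0`.
  refine ⟨s, hs, p, ![u, v, 0], fun j => hp j (mem_univ _), ?_, ?_, ?_⟩
  · intro j
    fin_cases j
    · exact hpD.2
    · change p 1 - p 2 = s • d 2
      rw [hd2, smul_sub, smul_neg, ← hpD.1, ← hpD.2]; abel
    · exact hpD.1
  · rw [Fin.sum_univ_three]
    simp only [Matrix.cons_val_zero, Matrix.cons_val_one, Matrix.cons_val, inner_zero_right,
      add_zero]
    rw [← hfD, hfuv, real_inner_comm, real_inner_comm v]
  · intro j y hy
    have := hmax j y hy
    fin_cases j
    all_goals
      simp [inner_sub_left, inner_sub_right] at this ⊢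
      linarith

/-! ### Action and length of absolutely continuous loops -/

lemma AbsolutelyContinuousOnInterval.continuousLinearMap_comp {E F : Type*}
    [NormedAddCommGroup E] [NormedSpace ℝ E] [NormedAddCommGroup F] [NormedSpace ℝ F]
    {f : ℝ → E} {a b : ℝ} (hf : AbsolutelyContinuousOnInterval f a b) (L : E →L[ℝ] F) :
    AbsolutelyContinuousOnInterval (fun t => L (f t)) a b := by
  refine squeeze_zero (fun t => Finset.sum_nonneg fun _ _ => dist_nonneg) (fun t => ?_)
    (by simpa using Filter.Tendsto.const_mul ‖L‖ hf)
  rw [Finset.mul_sum]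
  refine Finset.sum_le_sum fun i _ => ?_
  rw [dist_eq_norm, ← map_sub, dist_eq_norm]
  exact L.le_opNorm _

lemma AbsolutelyContinuousOnInterval.ae_deriv_clm {x : ℝ → PhaseSpace} {a b : ℝ}
    (hd : ∀ᵐ t, t ∈ uIcc a b → DifferentiableAt ℝ x t) (L : PhaseSpace →L[ℝ] ℝ) :
    ∀ᵐ t, t ∈ uIoc a b → deriv (fun t => L (x t)) t = L (deriv x t) := by
  filter_upwards [hd] with t ht hmem
  exact (L.hasFDerivAt.comp_hasDerivAt t (ht (uIoc_subset_uIcc hmem)).hasDerivAt).deriv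

lemma AbsolutelyContinuousOnInterval.intervalIntegrable_clm_deriv {x : ℝ → PhaseSpace} {a b : ℝ}
    (hx : AbsolutelyContinuousOnInterval x a b)
    (hd : ∀ᵐ t, t ∈ uIcc a b → DifferentiableAt ℝ x t) (L : PhaseSpace →L[ℝ] ℝ) :
    IntervalIntegrable (fun t => L (deriv x t)) volume a b := by
  refine (hx.continuousLinearMap_comp L).intervalIntegrable_deriv.congr_ae ?_
  rw [Filter.EventuallyEq, ae_restrict_iff' measurableSet_uIoc]
  exact ae_deriv_clm hd L

lemma AbsolutelyContinuousOnInterval.integral_clm_deriv {x : ℝ → PhaseSpace} {a b : ℝ}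
    (hx : AbsolutelyContinuousOnInterval x a b)
    (hd : ∀ᵐ t, t ∈ uIcc a b → DifferentiableAt ℝ x t) (L : PhaseSpace →L[ℝ] ℝ) :
    ∫ t in a..b, L (deriv x t) = L (x b) - L (x a) := by
  rw [← (hx.continuousLinearMap_comp L).integral_deriv_eq_sub]
  refine intervalIntegral.integral_congr_ae ?_
  filter_upwards [ae_deriv_clm hd L] with t ht hmem using (ht hmem).symm

/-- The `i`-th position coordinate on phase space. -/
noncomputable def phaseFst (i : Fin 2) : PhaseSpace →L[ℝ] ℝ :=
  (EuclideanSpace.proj i).comp (ContinuousLinearMap.fst ℝ Plane Plane)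

/-- The `i`-th momentum coordinate on phase space. -/
noncomputable def phaseSnd (i : Fin 2) : PhaseSpace →L[ℝ] ℝ :=
  (EuclideanSpace.proj i).comp (ContinuousLinearMap.snd ℝ Plane Plane)

lemma phaseInner_sympJ_left (v z : PhaseSpace) :
    phaseInner (sympJ v) z = inner ℝ v.2 z.1 - inner ℝ v.1 z.2 := by
  simp [phaseInner, sympJ, sub_eq_add_neg]

/-- Testing the subgradient against points that differ from `x t` in one factor only decouples the
product: the position velocity is normal to `B`, and minus the momentum velocity is normal to `A`.
-/
lemma IsClosedCharacteristic.ae_velocity {A B : Set Plane} {x : ℝ → PhaseSpace} (hA : IsClosed A) (hB : IsClosed B)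
    (hA0 : A ∈ nhds (0 : Plane)) (hB0 : B ∈ nhds (0 : Plane)) (hA' : Convex ℝ A)
    (hB' : Convex ℝ B) (hx : IsClosedCharacteristic (A ×ˢ B) x) :
    ∀ᵐ t, t ∈ Icc (0 : ℝ) 1 → DifferentiableAt ℝ x t ∧
      phaseInner (sympJ (deriv x t)) (x t) < 0 ∧
      (∀ y ∈ B, inner ℝ (deriv x t).1 y ≤ inner ℝ (deriv x t).1 (x t).2) ∧
      ∀ y ∈ A, inner ℝ (deriv x t).2 (x t).1 ≤ inner ℝ (deriv x t).2 y := by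
  have h := hx.velocity
  rw [ae_restrict_iff' measurableSet_Icc] at h
  filter_upwards [h] with t ht hmem
  obtain ⟨r, hr, w, hw, hd⟩ := ht hmem
  have hg := hx.gauge_eq_one t hmem
  have hmemC : x t ∈ A ×ˢ B := by
    have := (gauge_le_one_iff_mem_closure (hA'.prod hB') (prod_mem_nhds hA0 hB0)).1 hg.le
    rwa [(hA.prod hB).closure_eq] at this
  have h1 := phaseInner_self_of_mem_subdifferential hw
  rw [hg] at h1
  refine ⟨hd.differentiableAt, ?_, fun y hy => ?_, fun y hy => ?_⟩
  · rw [hd.deriv, phaseInner_sympJ_left]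
    simp only [phaseInner, sympJ, Prod.smul_mk, inner_neg_left, smul_neg,
      real_inner_smul_left] at *
    nlinarith
  · have := phaseInner_le_of_mem_subdifferential hw hg (y := ((x t).1, y)) ⟨hmemC.1, hy⟩
    rw [hd.deriv]
    simp only [phaseInner, sympJ, Prod.smul_mk, real_inner_smul_left] at *
    exact mul_le_mul_of_nonneg_left (by linarith) hr.le
  · have := phaseInner_le_of_mem_subdifferential hw hg (y := (y, (x t).2)) ⟨hy, hmemC.2⟩
    rw [hd.deriv]
    simp only [phaseInner, sympJ, Prod.smul_mk, real_inner_smul_left, inner_neg_left, smul_neg] at *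
    linarith [mul_le_mul_of_nonneg_left (by linarith :
      inner ℝ w.1 y ≤ inner ℝ w.1 (x t).1) hr.le]

lemma intervalIntegrable_inner_deriv_fst {x : ℝ → PhaseSpace} (hx : AbsolutelyContinuousOnInterval x 0 1)
    (hd : ∀ᵐ t, t ∈ uIcc (0 : ℝ) 1 → DifferentiableAt ℝ x t) :
    IntervalIntegrable (fun t => inner ℝ (deriv x t).1 (x t).2) volume 0 1 := by
  have h : ∀ i, IntervalIntegrable (fun t => phaseFst i (deriv x t) * phaseSnd i (x t))
      volume 0 1 := fun i =>
    (hx.intervalIntegrable_clm_deriv hd _).mul_continuousOn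
      ((phaseSnd i).continuous.comp_continuousOn hx.continuousOn)
  refine ((h 0).add (h 1)).congr_ae (Filter.Eventually.of_forall fun t => ?_)
  simp [PiLp.inner_apply, phaseFst, phaseSnd, mul_comm]

lemma intervalIntegrable_inner_deriv_snd {x : ℝ → PhaseSpace} (hx : AbsolutelyContinuousOnInterval x 0 1)
    (hd : ∀ᵐ t, t ∈ uIcc (0 : ℝ) 1 → DifferentiableAt ℝ x t) :
    IntervalIntegrable (fun t => inner ℝ (deriv x t).2 (x t).1) volume 0 1 := by
  have h : ∀ i, IntervalIntegrable (fun t => phaseSnd i (deriv x t) * phaseFst i (x t))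
      volume 0 1 := fun i =>
    (hx.intervalIntegrable_clm_deriv hd _).mul_continuousOn
      ((phaseFst i).continuous.comp_continuousOn hx.continuousOn)
  refine ((h 0).add (h 1)).congr_ae (Filter.Eventually.of_forall fun t => ?_)
  simp [PiLp.inner_apply, phaseFst, phaseSnd, mul_comm]

/-- Integration by parts, coordinate by coordinate; the boundary terms cancel on a loop. -/
lemma integral_inner_deriv_fst_add_snd {x : ℝ → PhaseSpace} (hx : AbsolutelyContinuousOnInterval x 0 1)
    (hd : ∀ᵐ t, t ∈ uIcc (0 : ℝ) 1 → DifferentiableAt ℝ x t) (hc : x 0 = x 1) :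
    (∫ t in (0 : ℝ)..1, inner ℝ (deriv x t).1 (x t).2) +
      ∫ t in (0 : ℝ)..1, inner ℝ (deriv x t).2 (x t).1 = 0 := by
  have h : ∀ i, ∫ t in (0 : ℝ)..1, (phaseFst i (deriv x t) * phaseSnd i (x t) +
      phaseFst i (x t) * phaseSnd i (deriv x t)) = 0 := by
    intro i
    have := (hx.continuousLinearMap_comp (phaseFst i)).integral_deriv_mul_eq_sub
      (hx.continuousLinearMap_comp (phaseSnd i))
    rw [hc, sub_self] at this
    refine Eq.trans ?_ this
    refine intervalIntegral.integral_congr_ae ?_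
    filter_upwards [AbsolutelyContinuousOnInterval.ae_deriv_clm hd (phaseFst i),
      AbsolutelyContinuousOnInterval.ae_deriv_clm hd (phaseSnd i)] with t h1 h2 hmem
    rw [h1 hmem, h2 hmem]
  have hi : ∀ i, IntervalIntegrable (fun t => phaseFst i (deriv x t) * phaseSnd i (x t) +
      phaseFst i (x t) * phaseSnd i (deriv x t)) volume 0 1 := fun i =>
    ((hx.intervalIntegrable_clm_deriv hd _).mul_continuousOn
      ((phaseSnd i).continuous.comp_continuousOn hx.continuousOn)).add
    ((hx.intervalIntegrable_clm_deriv hd _).continuousOn_mul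
      ((phaseFst i).continuous.comp_continuousOn hx.continuousOn))
  rw [← intervalIntegral.integral_add (intervalIntegrable_inner_deriv_fst hx hd)
    (intervalIntegrable_inner_deriv_snd hx hd)]
  have h2 : _ + _ = (0 : ℝ) + 0 := congrArg₂ (· + ·) (h 0) (h 1)
  simp only [add_zero] at h2
  rw [← intervalIntegral.integral_add (hi 0) (hi 1)] at h2
  refine Eq.trans ?_ h2
  refine intervalIntegral.integral_congr fun t _ => ?_
  simp [PiLp.inner_apply, phaseFst, phaseSnd]
  ring

lemma loopAction_eq_integral_fst {x : ℝ → PhaseSpace} (hx : AbsolutelyContinuousOnInterval x 0 1)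
    (hd : ∀ᵐ t, t ∈ uIcc (0 : ℝ) 1 → DifferentiableAt ℝ x t) (hc : x 0 = x 1) :
    loopAction x = ∫ t in (0 : ℝ)..1, inner ℝ (deriv x t).1 (x t).2 := by
  have h := integral_inner_deriv_fst_add_snd hx hd hc
  simp only [loopAction, phaseInner_sympJ_left]
  rw [intervalIntegral.integral_sub (intervalIntegrable_inner_deriv_snd hx hd)
    (intervalIntegrable_inner_deriv_fst hx hd)]
  linarith

lemma loopAction_eq_integral_snd {x : ℝ → PhaseSpace} (hx : AbsolutelyContinuousOnInterval x 0 1)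
    (hd : ∀ᵐ t, t ∈ uIcc (0 : ℝ) 1 → DifferentiableAt ℝ x t) (hc : x 0 = x 1) :
    loopAction x = -∫ t in (0 : ℝ)..1, inner ℝ (deriv x t).2 (x t).1 := by
  have h := integral_inner_deriv_fst_add_snd hx hd hc
  rw [loopAction_eq_integral_fst hx hd hc]
  linarith

lemma loopAction_pos {x : ℝ → PhaseSpace} (hx : AbsolutelyContinuousOnInterval x 0 1)
    (hd : ∀ᵐ t, t ∈ uIcc (0 : ℝ) 1 → DifferentiableAt ℝ x t)
    (hneg : ∀ᵐ t, t ∈ Icc (0 : ℝ) 1 → phaseInner (sympJ (deriv x t)) (x t) < 0) :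
    0 < loopAction x := by
  have h : 0 < ∫ t in (0 : ℝ)..1, -phaseInner (sympJ (deriv x t)) (x t) := by
    rw [intervalIntegral.integral_pos_iff_support_of_nonneg_ae']
    · refine ⟨zero_lt_one, ?_⟩
      have : (Ioc (0 : ℝ) 1) ≤ᵐ[volume] (Function.support
          (fun t => -phaseInner (sympJ (deriv x t)) (x t)) ∩ Ioc (0 : ℝ) 1 : Set ℝ) := by
        filter_upwards [hneg] with t ht hmem
        exact ⟨(neg_pos.2 (ht ⟨hmem.1.le, hmem.2⟩)).ne', hmem⟩
      refine lt_of_lt_of_le ?_ (measure_mono_ae this)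
      simp
    · rw [Filter.EventuallyLE, ae_restrict_iff' measurableSet_uIoc, uIoc_of_le zero_le_one]
      filter_upwards [hneg] with t ht hmem
      exact (neg_pos.2 (ht ⟨hmem.1.le, hmem.2⟩)).le
    · simp only [phaseInner_sympJ_left]
      exact ((intervalIntegrable_inner_deriv_snd hx hd).sub
        (intervalIntegrable_inner_deriv_fst hx hd)).neg
  rw [intervalIntegral.integral_neg] at h
  rw [loopAction]
  linarith

lemma inner_sub_le_integral {B : Set Plane} {x : ℝ → PhaseSpace}
    (hx : AbsolutelyContinuousOnInterval x 0 1)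
    (hd : ∀ᵐ t, t ∈ uIcc (0 : ℝ) 1 → DifferentiableAt ℝ x t)
    (hB : ∀ᵐ t, t ∈ Icc (0 : ℝ) 1 →
      ∀ y ∈ B, inner ℝ (deriv x t).1 y ≤ inner ℝ (deriv x t).1 (x t).2)
    {a b : ℝ} (ha : 0 ≤ a) (hab : a ≤ b) (hb : b ≤ 1) {y : Plane} (hy : y ∈ B) :
    inner ℝ ((x b).1 - (x a).1) y ≤ ∫ t in a..b, inner ℝ (deriv x t).1 (x t).2 := by
  have hsub : uIcc a b ⊆ uIcc (0 : ℝ) 1 := by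
    rw [uIcc_of_le hab, uIcc_of_le zero_le_one]; exact Icc_subset_Icc ha hb
  have hd' : ∀ᵐ t, t ∈ uIcc a b → DifferentiableAt ℝ x t := by
    filter_upwards [hd] with t ht hm using ht (hsub hm)
  let L : PhaseSpace →L[ℝ] ℝ := (innerSL ℝ y).comp (ContinuousLinearMap.fst ℝ Plane Plane)
  have hL : ∀ z, L z = inner ℝ z.1 y := fun z => real_inner_comm z.1 y
  have h1 := (hx.mono hsub).integral_clm_deriv hd' L
  have h2 := (hx.mono hsub).intervalIntegrable_clm_deriv hd' L
  simp only [hL] at h1 h2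
  rw [inner_sub_left, ← h1]
  refine intervalIntegral.integral_mono_ae_restrict hab h2
    ((intervalIntegrable_inner_deriv_fst hx hd).mono_set hsub) ?_
  rw [Filter.EventuallyLE, ae_restrict_iff' measurableSet_Icc]
  filter_upwards [hB] with t ht hm
  exact ht ⟨ha.trans hm.1, hm.2.trans hb⟩ y hy

/-- The action of a closed characteristic bounds the length of every triangle inscribed in its first
component. -/
lemma sum_inner_le_loopAction {B : Set Plane} {x : ℝ → PhaseSpace}
    (hx : AbsolutelyContinuousOnInterval x 0 1)
    (hd : ∀ᵐ t, t ∈ uIcc (0 : ℝ) 1 → DifferentiableAt ℝ x t) (hc : x 0 = x 1)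
    (hB : ∀ᵐ t, t ∈ Icc (0 : ℝ) 1 →
      ∀ y ∈ B, inner ℝ (deriv x t).1 y ≤ inner ℝ (deriv x t).1 (x t).2)
    {y : Fin 3 → Plane} (hy : ∀ j, y j ∈ B) {a b c : ℝ} (ha : 0 ≤ a) (hab : a ≤ b) (hbc : b ≤ c)
    (hc1 : c ≤ 1) :
    inner ℝ ((x b).1 - (x a).1) (y 0) + inner ℝ ((x c).1 - (x b).1) (y 1) +
      inner ℝ ((x a).1 - (x c).1) (y 2) ≤ loopAction x := by
  have hi := intervalIntegrable_inner_deriv_fst hx hd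
  have hsub : ∀ {u v : ℝ}, 0 ≤ u → u ≤ v → v ≤ 1 →
      IntervalIntegrable (fun t => inner ℝ (deriv x t).1 (x t).2) volume u v := by
    intro u v hu huv hv
    refine hi.mono_set ?_
    rw [uIcc_of_le huv, uIcc_of_le zero_le_one]; exact Icc_subset_Icc hu hv
  rw [loopAction_eq_integral_fst hx hd hc,
    ← intervalIntegral.integral_add_adjacent_intervals (hsub le_rfl ha (by linarith))
      (hsub ha (by linarith) le_rfl),
    ← intervalIntegral.integral_add_adjacent_intervals (hsub ha hab (by linarith))
      (hsub (by linarith) (by linarith) le_rfl),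
    ← intervalIntegral.integral_add_adjacent_intervals (hsub (by linarith) hbc hc1)
      (hsub (by linarith) hc1 le_rfl)]
  have e0 := inner_sub_le_integral hx hd hB le_rfl ha (by linarith) (hy 2)
  have e1 := inner_sub_le_integral hx hd hB ha hab (by linarith) (hy 0)
  have e2 := inner_sub_le_integral hx hd hB (by linarith) hbc hc1 (hy 1)
  have e3 := inner_sub_le_integral hx hd hB (by linarith) hc1 le_rfl (hy 2)
  -- The third arc passes through the base point: its pieces on `[c, 1]` and `[0, a]` join because
  -- the loop closes.
  rw [hc] at e0
  simp only [inner_sub_left] at *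
  linarith

/-- The first component of a closed characteristic has no translate in a smaller copy of `A`. -/
lemma one_le_of_translate_mem_smul {A : Set Plane} {x : ℝ → PhaseSpace}
    (hx : AbsolutelyContinuousOnInterval x 0 1)
    (hd : ∀ᵐ t, t ∈ uIcc (0 : ℝ) 1 → DifferentiableAt ℝ x t) (hc : x 0 = x 1)
    (hneg : ∀ᵐ t, t ∈ Icc (0 : ℝ) 1 → phaseInner (sympJ (deriv x t)) (x t) < 0)
    (hA : ∀ᵐ t, t ∈ Icc (0 : ℝ) 1 →
      ∀ y ∈ A, inner ℝ (deriv x t).2 (x t).1 ≤ inner ℝ (deriv x t).2 y)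
    {W : ℝ} (hW : 0 ≤ W) {v : Plane} (hv : ∀ t ∈ Icc (0 : ℝ) 1, ∃ y ∈ A, (x t).1 + v = W • y) :
    1 ≤ W := by
  have hpos := loopAction_pos hx hd hneg
  have hi := intervalIntegrable_inner_deriv_snd hx hd
  let L : PhaseSpace →L[ℝ] ℝ := (innerSL ℝ v).comp (ContinuousLinearMap.snd ℝ Plane Plane)
  have hL : ∀ z, L z = inner ℝ z.2 v := fun z => real_inner_comm z.2 v
  have h1 := hx.integral_clm_deriv hd L
  have h2 := hx.intervalIntegrable_clm_deriv hd L
  rw [hc, sub_self] at h1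
  simp only [hL] at h1 h2
  -- The integral of `inner ℝ (deriv x t).2 (x t).1` is minus the action, and the term with `v`
  -- integrates to zero on a loop. The inequality thus reads `-W * action ≤ -action`.
  have h3 : ∫ t in (0 : ℝ)..1, W * inner ℝ (deriv x t).2 (x t).1 ≤
      ∫ t in (0 : ℝ)..1, (inner ℝ (deriv x t).2 (x t).1 + inner ℝ (deriv x t).2 v) := by
    refine intervalIntegral.integral_mono_ae_restrict zero_le_one (hi.const_mul W) (hi.add h2) ?_
    rw [Filter.EventuallyLE, ae_restrict_iff' measurableSet_Icc]
    filter_upwards [hA] with t ht hm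
    obtain ⟨y, hy, hyv⟩ := hv t hm
    rw [← inner_add_right, hyv, inner_smul_right]
    exact mul_le_mul_of_nonneg_left (ht hm y hy) hW
  rw [intervalIntegral.integral_add hi h2, h1, intervalIntegral.integral_const_mul] at h3
  rw [loopAction_eq_integral_snd hx hd hc] at hpos
  nlinarith

/-! ### Area bounds from vertical chords -/

/-- The plane set `S` contains a vertical segment of length `l` over `x`. -/
def HasChord (S : Set (ℝ × ℝ)) (x l : ℝ) : Prop := ∃ y, (x, y) ∈ S ∧ (x, y + l) ∈ S

lemma HasChord.mono {S : Set (ℝ × ℝ)} (hS : Convex ℝ S) {x l l' : ℝ} (h : HasChord S x l)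
    (h0 : 0 ≤ l') (hl : l' ≤ l) : HasChord S x l' := by
  obtain ⟨y, h1, h2⟩ := h
  refine ⟨y, h1, ?_⟩
  rcases h0.eq_or_lt with rfl | h0
  · simpa using h1
  have := hS.add_smul_sub_mem h1 h2 (t := l' / l)
    ⟨by have := h0.trans_le hl; positivity, div_le_one_of_le₀ hl (by linarith)⟩
  simpa [div_mul_cancel₀ _ (h0.trans_le hl).ne'] using this

lemma volume_strip_ge {S : Set (ℝ × ℝ)} (hS : Convex ℝ S) {x₁ x₂ l₁ l₂ : ℝ} (hx : x₁ ≤ x₂)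
    (hl₁ : 0 ≤ l₁) (hl₂ : 0 ≤ l₂) (h₁ : HasChord S x₁ l₁) (h₂ : HasChord S x₂ l₂) :
    ENNReal.ofReal ((x₂ - x₁) * (l₁ + l₂) / 2) ≤ volume (S ∩ Ioc x₁ x₂ ×ˢ univ) := by
  rcases hx.eq_or_lt with rfl | hx'
  · simp
  obtain ⟨y₁, h₁, h₁'⟩ := h₁
  obtain ⟨y₂, h₂, h₂'⟩ := h₂
  have hpos : 0 < x₂ - x₁ := sub_pos.2 hx'
  set f : ℝ → ℝ := fun x => y₁ + (x - x₁) / (x₂ - x₁) * (y₂ - y₁) with hf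
  set g : ℝ → ℝ := fun x => y₁ + l₁ + (x - x₁) / (x₂ - x₁) * (y₂ + l₂ - (y₁ + l₁)) with hg
  have hθ : ∀ x ∈ Ioc x₁ x₂, (x - x₁) / (x₂ - x₁) ∈ Icc (0 : ℝ) 1 := fun x hx =>
    ⟨div_nonneg (by linarith [hx.1]) hpos.le, (div_le_one hpos).2 (by linarith [hx.2])⟩
  have hfg : ∀ x ∈ Ioc x₁ x₂, f x ≤ g x := by
    intro x hx
    obtain ⟨h0, h1⟩ := hθ x hx
    simp only [hf, hg]
    nlinarith [mul_nonneg h0 hl₂, mul_nonneg (sub_nonneg.2 h1) hl₁]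
  have hcf : Continuous f := by fun_prop
  have hcg : Continuous g := by fun_prop
  have hsub : regionBetween f g (Ioc x₁ x₂) ⊆ S ∩ Ioc x₁ x₂ ×ˢ univ := by
    rintro ⟨x, y⟩ ⟨hx, hy⟩
    refine ⟨?_, hx, mem_univ _⟩
    have e : x₁ + (x - x₁) / (x₂ - x₁) * (x₂ - x₁) = x := by
      rw [div_mul_cancel₀ _ hpos.ne']; ring
    have m1 : (x, f x) ∈ S := by simpa [e] using hS.add_smul_sub_mem h₁ h₂ (hθ x hx)
    have m2 : (x, g x) ∈ S := by simpa [e] using hS.add_smul_sub_mem h₁' h₂' (hθ x hx)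
    have hlt : 0 < g x - f x := by linarith [hy.1, hy.2]
    have := hS.add_smul_sub_mem m1 m2 (t := (y - f x) / (g x - f x))
      ⟨div_nonneg (by linarith [hy.1]) hlt.le, (div_le_one hlt).2 (by linarith [hy.2])⟩
    simpa [div_mul_cancel₀ _ hlt.ne'] using this
  refine le_trans (le_of_eq ?_) (measure_mono hsub)
  rw [Measure.volume_eq_prod, volume_regionBetween_eq_integral
    (hcf.integrableOn_Ioc) (hcg.integrableOn_Ioc) measurableSet_Ioc hfg,
    ← intervalIntegral.integral_of_le hx]
  congr 1
  set m := (l₂ - l₁) / (x₂ - x₁) with hm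
  have hgf : ∀ x, (g - f) x = (l₁ - m * x₁) + m * x := fun x => by
    simp only [Pi.sub_apply, hf, hg, hm]; ring
  simp only [hgf]
  rw [intervalIntegral.integral_add (Continuous.intervalIntegrable (by fun_prop) _ _)
    (Continuous.intervalIntegrable (by fun_prop) _ _), intervalIntegral.integral_const,
    intervalIntegral.integral_const_mul, integral_id, smul_eq_mul]
  have : m * (x₂ - x₁) = l₂ - l₁ := div_mul_cancel₀ _ hpos.ne'
  linear_combination (-(x₂ - x₁) / 2) * this

lemma volume_strip_add {S : Set (ℝ × ℝ)} (hS : MeasurableSet S) {x₁ x₂ x₃ u v : ℝ}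
    (h₁₂ : x₁ ≤ x₂) (h₂₃ : x₂ ≤ x₃) (hu : 0 ≤ u) (hv : 0 ≤ v)
    (h1 : ENNReal.ofReal u ≤ volume (S ∩ Ioc x₁ x₂ ×ˢ univ))
    (h2 : ENNReal.ofReal v ≤ volume (S ∩ Ioc x₂ x₃ ×ˢ univ)) :
    ENNReal.ofReal (u + v) ≤ volume (S ∩ Ioc x₁ x₃ ×ˢ univ) := by
  rw [ENNReal.ofReal_add hu hv, ← Ioc_union_Ioc_eq_Ioc h₁₂ h₂₃, union_prod, inter_union_distrib_left,
    measure_union]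
  · exact add_le_add h1 h2
  · refine Disjoint.mono inter_subset_right inter_subset_right (Disjoint.set_prod_left ?_ _ _)
    exact Ioc_disjoint_Ioc_of_le le_rfl
  · exact hS.inter (measurableSet_Ioc.prod MeasurableSet.univ)

/-- The trapezoidal rule is a lower bound for convex sets. Configurations with fewer chords repeat
one, which creates strips of width zero. -/
lemma volume_ge_of_chords {S : Set (ℝ × ℝ)} (hS : Convex ℝ S) (hm : MeasurableSet S)
    {x₁ x₂ x₃ x₄ x₅ l₁ l₂ l₃ l₄ l₅ : ℝ} (h₁ : HasChord S x₁ l₁) (h₂ : HasChord S x₂ l₂)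
    (h₃ : HasChord S x₃ l₃) (h₄ : HasChord S x₄ l₄) (h₅ : HasChord S x₅ l₅)
    (h₁₂ : x₁ ≤ x₂) (h₂₃ : x₂ ≤ x₃) (h₃₄ : x₃ ≤ x₄) (h₄₅ : x₄ ≤ x₅)
    (hl₁ : 0 ≤ l₁) (hl₂ : 0 ≤ l₂) (hl₃ : 0 ≤ l₃) (hl₄ : 0 ≤ l₄) (hl₅ : 0 ≤ l₅) :
    ENNReal.ofReal ((x₂ - x₁) * (l₁ + l₂) / 2 + ((x₃ - x₂) * (l₂ + l₃) / 2 +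
      ((x₄ - x₃) * (l₃ + l₄) / 2 + (x₅ - x₄) * (l₄ + l₅) / 2))) ≤ volume S := by
  have nn : ∀ {a b l m : ℝ}, a ≤ b → 0 ≤ l → 0 ≤ m → 0 ≤ (b - a) * (l + m) / 2 :=
    fun hab hl hm => by have := sub_nonneg.2 hab; positivity
  refine le_trans ?_ (measure_mono (inter_subset_left (t := Ioc x₁ x₅ ×ˢ univ)))
  have n3 := nn h₁₂ hl₁ hl₂
  have n4 := nn h₂₃ hl₂ hl₃
  have n5 := nn h₃₄ hl₃ hl₄
  have n6 := nn h₄₅ hl₄ hl₅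
  exact volume_strip_add hm h₁₂ (by linarith) n3 (by linarith)
    (volume_strip_ge hS h₁₂ hl₁ hl₂ h₁ h₂)
    (volume_strip_add hm h₂₃ (by linarith) n4 (by linarith)
      (volume_strip_ge hS h₂₃ hl₂ hl₃ h₂ h₃)
      (volume_strip_add hm h₃₄ h₄₅ n5 n6 (volume_strip_ge hS h₃₄ hl₃ hl₄ h₃ h₄)
        (volume_strip_ge hS h₄₅ hl₄ hl₅ h₄ h₅)))

/-- A convex set that contains a vertical chord of length `c` and two opposite triangles with
vertical sides of length `c * k` and width `c`. -/
lemma volume_ge_of_triangles {S : Set (ℝ × ℝ)} (hS : Convex ℝ S) (hm : MeasurableSet S)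
    {c k α β x₀ : ℝ} (hc : 0 < c) (hk : 0 ≤ k) (hk1 : k ≤ 1)
    (h₁ : HasChord S α (c * k)) (h₂ : HasChord S (α + c) 0)
    (h₃ : HasChord S β 0) (h₄ : HasChord S (β + c) (c * k)) (h₀ : HasChord S x₀ c) :
    ENNReal.ofReal (c ^ 2 / (2 - k)) ≤ volume S := by
  have hck : 0 ≤ c * k := mul_nonneg hc.le hk
  have h₀' : HasChord S x₀ 0 := h₀.mono hS le_rfl hc.le
  have hmin : HasChord S (min β x₀) 0 := by rcases min_choice β x₀ with h | h <;> rwa [h]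
  have hmax : HasChord S (max (α + c) x₀) 0 := by
    rcases max_choice (α + c) x₀ with h | h <;> rwa [h]
  have m1 := min_le_left β x₀
  have m2 := min_le_right β x₀
  have m3 := le_max_left (α + c) x₀
  have m4 := le_max_right (α + c) x₀
  have h2k : 0 < 2 - k := by linarith
  have hk' : 0 ≤ 1 - k := by linarith
  have hkk : 0 ≤ c * c * (k * (1 - k)) := by positivity
  suffices h : ∃ V, ENNReal.ofReal V ≤ volume S ∧ 2 * c ^ 2 ≤ (2 * V) * (2 - k) by
    obtain ⟨V, hV, h⟩ := h
    refine le_trans (ENNReal.ofReal_le_ofReal ?_) hV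
    rw [div_le_iff₀ h2k]; linarith
  -- If the apexes `β` and `α + c` are far apart, the hull of both and the long chord suffices: its
  -- width is at least `2 * c / (2 - k)`. At the threshold this bound agrees with that of the main
  -- case below.
  by_cases hD : c * k ≤ (α - β) * (2 - k)
  · refine ⟨_, volume_ge_of_chords hS hm hmin hmin h₀ hmax hmax le_rfl m2 m4 le_rfl
      le_rfl le_rfl hc.le le_rfl le_rfl, ?_⟩
    have := mul_le_mul_of_nonneg_left hD hc.le
    have e := mul_nonneg (mul_nonneg hc.le h2k.le)
      (by linarith : 0 ≤ max (α + c) x₀ - min β x₀ - (c + (α - β)))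
    linarith
  · push Not at hD
    have hαβ : α ≤ β + c := by nlinarith
    -- Uses `(1 + k) * (2 - k) = 2 + k * (1 - k) ≥ 2`.
    have key : ∀ V, c * c * (1 + k) ≤ 2 * V → 2 * c ^ 2 ≤ (2 * V) * (2 - k) := fun V hV => by
      have := mul_le_mul_of_nonneg_right hV h2k.le
      linarith
    have hfac : 0 ≤ c * k + c := by linarith
    rcases lt_or_ge x₀ α with hx | hx
    · rcases le_or_gt β α with hβ | hβ
      · refine ⟨_, volume_ge_of_chords hS hm hmin h₀ h₄ h₂ h₂ m2 (by linarith) (by linarith)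
          le_rfl le_rfl hc.le hck le_rfl le_rfl, key _ ?_⟩
        have e1 := mul_nonneg hck (by linarith : 0 ≤ α - x₀)
        have e2 := mul_nonneg hc.le (by linarith : 0 ≤ β - min β x₀)
        linarith
      · refine ⟨_, volume_ge_of_chords hS hm h₀ h₀ h₀ h₄ h₄ le_rfl le_rfl (by linarith)
          le_rfl hc.le hc.le hc.le hck hck, key _ ?_⟩
        have e1 := mul_nonneg hfac (by linarith : 0 ≤ β - x₀)
        linarith
    rcases lt_or_ge (β + c) x₀ with hx' | hx'
    · rcases le_or_gt β α with hβ | hβ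
      · refine ⟨_, volume_ge_of_chords hS hm h₃ h₁ h₀ hmax hmax hβ hx m4 le_rfl
          le_rfl hck hc.le le_rfl le_rfl, key _ ?_⟩
        have e1 := mul_nonneg hck (by linarith : 0 ≤ x₀ - (β + c))
        have e2 := mul_nonneg hc.le (by linarith : 0 ≤ max (α + c) x₀ - (α + c))
        linarith
      · refine ⟨_, volume_ge_of_chords hS hm h₁ h₁ h₁ h₀ h₀ le_rfl le_rfl hx
          le_rfl hck hck hck hc.le hc.le, key _ ?_⟩
        have e1 := mul_nonneg hfac (by linarith : 0 ≤ x₀ - (α + c))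
        linarith
    rcases le_or_gt β α with hβ | hβ
    -- The main case: the overlap costs `(α - β) * c * (1 - k)` against `c * c * (1 + k)`, and the
    -- failure of `hD` is exactly what pays for it.
    · refine ⟨_, volume_ge_of_chords hS hm h₃ h₁ h₀ h₄ h₂ hβ hx hx' (by linarith)
        le_rfl hck hc.le hck le_rfl, ?_⟩
      have e1 := mul_nonneg (mul_nonneg hc.le hk') (sub_nonneg.2 hD.le)
      linarith
    · refine ⟨_, volume_ge_of_chords hS hm h₁ h₁ h₀ h₄ h₄ le_rfl hx hx' le_rfl
        hck hck hc.le hck hck, key _ ?_⟩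
      have e1 := mul_nonneg hfac (by linarith : 0 ≤ β - α)
      linarith

/-! ### Dual coordinates and the shape of the trapezoid -/

/-- The effect on areas of taking the inner products with two vectors. -/
lemma volume_image_inner_pair (u v : Plane) (S : Set Plane) :
    volume ((fun p : Plane => (inner ℝ u p, inner ℝ v p)) '' S) =
      ENNReal.ofReal |u 0 * v 1 - u 1 * v 0| * volume S := by
  let M : Matrix (Fin 2) (Fin 2) ℝ := !![u 0, u 1; v 0, v 1]
  have e1 : (fun p : Plane => (inner ℝ u p, inner ℝ v p)) '' S =
      (MeasurableEquiv.finTwoArrow (α := ℝ)) '' (Matrix.toLin' M ''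
        ((MeasurableEquiv.toLp 2 (Fin 2 → ℝ)).symm '' S)) := by
    rw [image_image, image_image]
    refine image_congr fun p _ => ?_
    simp [M, PiLp.inner_apply, dotProduct,
      MeasurableEquiv.finTwoArrow, mul_comm]
  rw [e1, MeasurableEquiv.image_eq_preimage_symm,
    (volume_preserving_finTwoArrow ℝ).symm.measure_preimage_equiv,
    Measure.addHaar_image_linearMap, MeasurableEquiv.image_eq_preimage_symm,
    (EuclideanSpace.volume_preserving_symm_measurableEquiv_toLp
      (Fin 2)).symm.measure_preimage_equiv]
  simp [M, LinearMap.det_toLin', Matrix.det_fin_two]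

/-- The trapezoid with corner `a` cut out by the coordinate functionals `e'`, `f'`. -/
def frameRegion (a e' f' : Plane) (k : ℝ) : Set Plane :=
  {q | 0 ≤ inner ℝ f' (q - a) ∧ inner ℝ f' (q - a) ≤ 1 ∧ 0 ≤ inner ℝ e' (q - a) ∧
    inner ℝ e' (q - a) + k * inner ℝ f' (q - a) ≤ 1}

/-- The basis `e`, `f` of the plane is dual to `e'`, `f'`. -/
structure IsDualFrame (e f e' f' : Plane) : Prop where
  ee : inner ℝ e' e = 1
  ef : inner ℝ e' f = 0
  fe : inner ℝ f' e = 0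
  ff : inner ℝ f' f = 1

lemma isClosed_frameRegion (a e' f' : Plane) (k : ℝ) : IsClosed (frameRegion a e' f' k) := by
  simp only [frameRegion, ofPred_and]
  refine (isClosed_le ?_ ?_).inter ((isClosed_le ?_ ?_).inter ((isClosed_le ?_ ?_).inter
    (isClosed_le ?_ ?_))) <;> fun_prop

lemma convex_frameRegion (a e' f' : Plane) (k : ℝ) : Convex ℝ (frameRegion a e' f' k) := by
  rintro x ⟨x1, x2, x3, x4⟩ y ⟨y1, y2, y3, y4⟩ s t hs ht hst
  have e : s • x + t • y - a = s • (x - a) + t • (y - a) := by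
    rw [smul_sub, smul_sub, sub_add_sub_comm, ← add_smul, hst, one_smul]
  simp only [frameRegion, mem_ofPred_eq, e, inner_add_right, inner_smul_right]
  refine ⟨by positivity, ?_, by positivity, ?_⟩
  · linarith [mul_le_mul_of_nonneg_left x2 hs, mul_le_mul_of_nonneg_left y2 ht]
  · linarith [mul_le_mul_of_nonneg_left x4 hs, mul_le_mul_of_nonneg_left y4 ht]

lemma image_sub_frameRegion (a e' f' q₀ : Plane) (k : ℝ) :
    (fun q => q - q₀) '' frameRegion a e' f' k = frameRegion (a - q₀) e' f' k := by
  ext q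
  constructor
  · rintro ⟨y, hy, rfl⟩
    simpa [frameRegion] using hy
  · intro hq
    refine ⟨q + q₀, ?_, by simp⟩
    simpa [frameRegion, sub_sub_eq_add_sub] using hq

/-- Dual coordinates for a parallelogram. -/
lemma exists_dual_frame {e f : Plane} (hD : e 0 * f 1 - e 1 * f 0 ≠ 0) :
    ∃ e' f' : Plane, IsDualFrame e f e' f' ∧
      (∀ x : Plane, x = inner ℝ e' x • e + inner ℝ f' x • f) ∧
      |f' 0 * e' 1 - f' 1 * e' 0| * |e 0 * f 1 - e 1 * f 0| = 1 := by
  set D := e 0 * f 1 - e 1 * f 0 with hDdef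
  refine ⟨!₂[f 1 / D, -f 0 / D], !₂[-e 1 / D, e 0 / D], ⟨?_, ?_, ?_, ?_⟩, ?_, ?_⟩
  · simp [PiLp.inner_apply]; field_simp; rw [hDdef]; ring
  · simp [PiLp.inner_apply]; field_simp; ring
  · simp [PiLp.inner_apply]; field_simp; ring
  · simp [PiLp.inner_apply]; field_simp; rw [hDdef]; ring
  · intro x
    ext i
    fin_cases i
    · simp [PiLp.inner_apply]; field_simp; rw [hDdef]; ring
    · simp [PiLp.inner_apply]; field_simp; rw [hDdef]; ring
  · rw [← abs_mul, abs_eq_abs.2 (Or.inr ?_ : _ ∨ _ = -(1 : ℝ)), abs_one]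
    simp; field_simp; rw [hDdef]; ring

lemma convexHull_eq_frameRegion {a e f e' f' : Plane} {k : ℝ} (hk1 : k ≤ 1)
    (h : IsDualFrame e f e' f') (hx : ∀ x : Plane, x = inner ℝ e' x • e + inner ℝ f' x • f) :
    convexHull ℝ {a, a + e, a + f + (1 - k) • e, a + f} = frameRegion a e' f' k := by
  obtain ⟨ee, ef, fe, ff⟩ := h
  apply Subset.antisymm
  · refine convexHull_min ?_ (convex_frameRegion a e' f' k)
    rintro q (rfl | rfl | rfl | rfl)
    · simp [frameRegion]
    · simp [frameRegion, ee, fe]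
    · simp [frameRegion, ee, fe, ef, ff, inner_add_right, inner_smul_right, add_assoc, hk1]
    · simp [frameRegion, ef, ff, hk1]
  · rintro q ⟨h1, h2, h3, h4⟩
    have hq := hx (q - a)
    set s := inner ℝ e' (q - a)
    set t := inner ℝ f' (q - a)
    have hconv := convex_convexHull ℝ ({a, a + e, a + f + (1 - k) • e, a + f} : Set Plane)
    have hsub := subset_convexHull ℝ ({a, a + e, a + f + (1 - k) • e, a + f} : Set Plane)
    have m1 := hconv.add_smul_sub_mem (hsub (by simp : a ∈ _)) (hsub (by simp : a + f ∈ _))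
      (t := t) ⟨h1, h2⟩
    have m2 := hconv.add_smul_sub_mem (hsub (by simp : a + e ∈ _))
      (hsub (by simp : a + f + (1 - k) • e ∈ _)) (t := t) ⟨h1, h2⟩
    have m3 := hconv.add_smul_sub_mem m1 m2 (t := s / (1 - k * t))
      ⟨div_nonneg h3 (by linarith), div_le_one_of_le₀ (by linarith) (by linarith)⟩
    -- The horizontal section at height `t` has length `1 - k * t`. It degenerates only at the apex
    -- of a triangle, where `s = 0` as well.
    have hst : s / (1 - k * t) * (1 - k * t) = s := by
      rcases eq_or_ne (1 - k * t) 0 with h0 | h0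
      · rw [h0, mul_zero]; linarith
      · exact div_mul_cancel₀ _ h0
    convert m3 using 1
    rw [← sub_add_cancel q a, hq]
    nth_rewrite 1 [← hst]
    module

lemma IsTrapezoid.exists_frame {Q : Set Plane} (hQ : IsTrapezoid Q) :
    ∃ (a e f e' f' : Plane) (k : ℝ), 0 ≤ k ∧ k ≤ 1 ∧ IsDualFrame e f e' f' ∧
      |f' 0 * e' 1 - f' 1 * e' 0| * |e 0 * f 1 - e 1 * f 0| = 1 ∧ Q = frameRegion a e' f' k := by
  obtain ⟨a, b, c, d, hind, ⟨r, hr, hcd⟩, rfl⟩ := hQ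
  have hD : (b - a) 0 * (d - a) 1 - (b - a) 1 * (d - a) 0 ≠ 0 := by
    intro hD
    rw [affineIndependent_iff_linearIndependent_vsub ℝ _ (0 : Fin 3)] at hind
    have hpair : LinearIndependent ℝ ![b - a, d - a] := by
      have := hind.comp ![⟨1, by decide⟩, ⟨2, by decide⟩] (by
        intro i j; fin_cases i <;> fin_cases j <;> simp)
      rwa [show (fun i : { x : Fin 3 // x ≠ 0 } => ![a, b, d] ↑i -ᵥ ![a, b, d] 0) ∘
        ![⟨1, by decide⟩, ⟨2, by decide⟩] = ![b - a, d - a] from by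
          ext i; fin_cases i <;> simp] at this
    rw [LinearIndependent.pair_iff] at hpair
    have h0 := hpair ((d - a) 0) (-(b - a) 0) (by
      ext i; fin_cases i <;> simp at hD ⊢ <;> linarith)
    have h1 := hpair ((d - a) 1) (-(b - a) 1) (by
      ext i; fin_cases i <;> simp at hD ⊢ <;> linarith)
    have hb : b - a = 0 := by
      ext i; fin_cases i
      · exact neg_eq_zero.1 h0.2
      · exact neg_eq_zero.1 h1.2
    exact absurd (hpair 1 0 (by simp [hb])).1 one_ne_zero
  -- The frame is placed on the longer of the two parallel sides, so that `k` lies in `[0, 1]`.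
  rcases le_or_gt r 1 with h1 | h1
  · obtain ⟨e', f', hf, hx, hdet⟩ := exists_dual_frame hD
    refine ⟨a, b - a, d - a, e', f', 1 - r, by linarith, by linarith, hf, hdet, ?_⟩
    rw [← convexHull_eq_frameRegion (by linarith) hf hx]
    have : c = d + r • (b - a) := by rw [← hcd]; abel
    simp [this]
  · have hD' : (c - d) 0 * (a - d) 1 - (c - d) 1 * (a - d) 0 ≠ 0 := by
      rw [hcd]
      intro h
      refine mul_ne_zero (by linarith : -r ≠ 0) hD (Eq.trans ?_ h)
      simp
      ring
    obtain ⟨e', f', hf, hx, hdet⟩ := exists_dual_frame hD'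
    have hr1 : r⁻¹ ≤ 1 := inv_le_one_of_one_le₀ h1.le
    refine ⟨d, c - d, a - d, e', f', 1 - r⁻¹, by linarith, by linarith [inv_nonneg.2 hr], hf,
      hdet, ?_⟩
    rw [← convexHull_eq_frameRegion (by linarith [inv_nonneg.2 hr]) hf hx]
    have : b = a + r⁻¹ • (c - d) := by
      rw [hcd, smul_smul, inv_mul_cancel₀ (by linarith), one_smul]; abel
    have e1 : d + (c - d) = c := by abel
    have e2 : d + (a - d) = a := by abel
    rw [e1, e2, sub_sub_cancel, ← this]
    congr 1
    ext y
    simp only [mem_insert_iff, mem_singleton_iff]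
    tauto

/-! ### From inscribed triangles to translates -/

/-- The set `T` contains a closed triangle with the edges `c • d j`. -/
def HasTriangle (T : Set Plane) (c : ℝ) (d : Fin 3 → Plane) : Prop :=
  ∃ p : Fin 3 → Plane, (∀ j, p j ∈ T) ∧ ∀ j, p j - p (j + 1) = c • d (j + 1)

lemma HasTriangle.mono {T : Set Plane} (hT : Convex ℝ T) {c s : ℝ} {d : Fin 3 → Plane}
    (h : HasTriangle T s d) (hc : 0 < c) (hcs : c ≤ s) : HasTriangle T c d := by
  obtain ⟨p, hp, hpd⟩ := h
  have hs := hc.trans_le hcs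
  refine ⟨fun j => p 0 + (c / s) • (p j - p 0), fun j =>
    hT.add_smul_sub_mem (hp 0) (hp j) ⟨by positivity, (div_le_one hs).2 hcs⟩, fun j => ?_⟩
  rw [add_sub_add_left_eq_sub, ← smul_sub, sub_sub_sub_cancel_right, hpd, smul_smul,
    div_mul_cancel₀ _ hs.ne']

/-- The number `A` bounds from above the `T`-length of the triangles inscribed in the cyclically
ordered family of points `q`. -/
def BoundsTriangles {ι : Type*} [LinearOrder ι] (T : Set Plane) (q : ι → Plane) (A : ℝ) : Prop :=
  ∀ y : Fin 3 → Plane, (∀ j, y j ∈ T) → ∀ i₀ i₁ i₂ : ι, i₀ ≤ i₁ → i₁ ≤ i₂ →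
    inner ℝ (q i₁ - q i₀) (y 0) + inner ℝ (q i₂ - q i₁) (y 1) + inner ℝ (q i₀ - q i₂) (y 2) ≤ A

/-- Summation by parts moves the differences from `q` to the triangle in `T`. Rotating the vertices
of that triangle covers every cyclic order of the indices. -/
lemma BoundsTriangles.mul_sum_le {ι : Type*} [LinearOrder ι] {T : Set Plane} {q : ι → Plane}
    {A c : ℝ} (h : BoundsTriangles T q A) {d : Fin 3 → Plane} (hd : HasTriangle T c d)
    {i₀ i₁ i₂ : ι} (hi : (i₀ ≤ i₁ ∧ i₁ ≤ i₂) ∨ (i₁ ≤ i₂ ∧ i₂ ≤ i₀) ∨ (i₂ ≤ i₀ ∧ i₀ ≤ i₁)) :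
    c * (inner ℝ (d 0) (q i₀) + inner ℝ (d 1) (q i₁) + inner ℝ (d 2) (q i₂)) ≤ A := by
  obtain ⟨p, hp, hpd⟩ := hd
  have e0 : inner ℝ (p 2 - p 0) (q i₀) = c * inner ℝ (d 0) (q i₀) := by
    rw [← real_inner_smul_left, ← show p 2 - p 0 = c • d 0 from hpd 2]
  have e1 : inner ℝ (p 0 - p 1) (q i₁) = c * inner ℝ (d 1) (q i₁) := by
    rw [← real_inner_smul_left, ← show p 0 - p 1 = c • d 1 from hpd 0]
  have e2 : inner ℝ (p 1 - p 2) (q i₂) = c * inner ℝ (d 2) (q i₂) := by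
    rw [← real_inner_smul_left, ← show p 1 - p 2 = c • d 2 from hpd 1]
  have key : inner ℝ (q i₁ - q i₀) (p 0) + inner ℝ (q i₂ - q i₁) (p 1) +
      inner ℝ (q i₀ - q i₂) (p 2) =
      c * (inner ℝ (d 0) (q i₀) + inner ℝ (d 1) (q i₁) + inner ℝ (d 2) (q i₂)) := by
    rw [mul_add, mul_add, ← e0, ← e1, ← e2]
    simp only [inner_sub_left, real_inner_comm (q _) (p _)]
    ring
  rw [← key]
  rcases hi with ⟨h1, h2⟩ | ⟨h1, h2⟩ | ⟨h1, h2⟩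
  · exact h p hp _ _ _ h1 h2
  · have := h ![p 1, p 2, p 0] (by intro j; fin_cases j <;> simp [hp]) _ _ _ h1 h2
    simp only [Matrix.cons_val_zero, Matrix.cons_val_one, Matrix.cons_val] at this
    linarith
  · have := h ![p 2, p 0, p 1] (by intro j; fin_cases j <;> simp [hp]) _ _ _ h1 h2
    simp only [Matrix.cons_val_zero, Matrix.cons_val_one, Matrix.cons_val] at this
    linarith

/-- The normals of the two parallel sides of a trapezoid. -/
def chordNormals (f' : Plane) : Fin 3 → Plane := ![f', -f', 0]

/-- The normals of a triangle formed by sides of a trapezoid. -/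
def triangleNormals (e' f' : Plane) (k : ℝ) : Fin 3 → Plane := ![e' + k • f', -e', -(k • f')]

/-- The normals of a triangle formed by sides of a trapezoid, in the opposite cyclic order. -/
def oppositeNormals (e' f' : Plane) (k : ℝ) : Fin 3 → Plane := ![e' + k • f', -(k • f'), -e']

/-- A cyclic family of points whose inscribed triangles have `T`-length at most `A` has a translate
in a copy of the trapezoid scaled by `A / c`. -/
lemma BoundsTriangles.exists_translate {ι : Type*} [LinearOrder ι] {T : Set Plane} {q : ι → Plane}
    {A c k : ℝ} (h : BoundsTriangles T q A) (hA : 0 < A) (hc : 0 < c) {a e f e' f' : Plane}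
    (hfr : IsDualFrame e f e' f')
    (h1 : HasTriangle T c (chordNormals f')) (h2 : HasTriangle T c (triangleNormals e' f' k))
    (h3 : HasTriangle T c (oppositeNormals e' f' k)) {i j : ι}
    (hi : ∀ l, inner ℝ e' (q i) ≤ inner ℝ e' (q l)) (hj : ∀ l, inner ℝ f' (q j) ≤ inner ℝ f' (q l)) :
    ∃ v : Plane, ∀ l, ∃ y ∈ frameRegion a e' f' k, q l + v = (A / c) • y := by
  have hAc : 0 < A / c := div_pos hA hc
  set m := inner ℝ e' (q i)
  set n := inner ℝ f' (q j)
  refine ⟨(A / c) • a - (m • e + n • f), fun l =>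
    ⟨a + (A / c)⁻¹ • (q l - (m • e + n • f)), ?_, ?_⟩⟩
  · have b1 : c * (inner ℝ f' (q l) - n) ≤ A := by
      -- The third normal is zero, so its index is free and a repeated one always respects the
      -- cyclic order.
      have := h.mul_sum_le h1 (i₀ := l) (i₁ := j) (i₂ := j) (by
        rcases le_total l j with h | h <;> simp [h])
      simp only [chordNormals, Matrix.cons_val_zero, Matrix.cons_val_one, Matrix.cons_val,
        inner_neg_left, inner_zero_left] at this
      linarith
    have b2 : c * (inner ℝ e' (q l) + k * inner ℝ f' (q l) - m - k * n) ≤ A := by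
      -- The order in which the curve visits the points that realize the three extreme values is
      -- unknown; this is why both orders of the normals are needed.
      by_cases hcyc : (l ≤ i ∧ i ≤ j) ∨ (i ≤ j ∧ j ≤ l) ∨ (j ≤ l ∧ l ≤ i)
      · have := h.mul_sum_le h2 hcyc
        simp only [triangleNormals, Matrix.cons_val_zero, Matrix.cons_val_one, Matrix.cons_val,
          inner_neg_left, inner_add_left, real_inner_smul_left] at this
        linarith
      · have := h.mul_sum_le h3 (i₀ := l) (i₁ := j) (i₂ := i) (by
          rcases le_total l i with h1 | h1 <;> rcases le_total l j with h2 | h2 <;>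
            rcases le_total i j with h3 | h3 <;> simp_all)
        simp only [oppositeNormals, Matrix.cons_val_zero, Matrix.cons_val_one, Matrix.cons_val,
          inner_neg_left, inner_add_left, real_inner_smul_left] at this
        linarith
    rw [mul_comm, ← le_div_iff₀ hc] at b1 b2
    have g1 := hi l
    have g2 := hj l
    simp only [frameRegion, mem_ofPred_eq, add_sub_cancel_left, inner_smul_right, inner_sub_right,
      inner_add_right, hfr.ee, hfr.ef, hfr.fe, hfr.ff]
    refine ⟨mul_nonneg (inv_nonneg.2 hAc.le) (by linarith), ?_,
      mul_nonneg (inv_nonneg.2 hAc.le) (by linarith), ?_⟩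
    · rw [inv_mul_le_one₀ hAc]; linarith
    · rw [← mul_assoc, mul_comm k, mul_assoc, ← mul_add, inv_mul_le_one₀ hAc]; linarith
  · rw [smul_add, smul_smul, mul_inv_cancel₀ hAc.ne', one_smul]; abel

lemma sum_triangleNormals (e' f' : Plane) (k : ℝ) : ∑ j, triangleNormals e' f' k j = 0 := by
  simp [Fin.sum_univ_three, triangleNormals]

lemma sum_oppositeNormals (e' f' : Plane) (k : ℝ) : ∑ j, oppositeNormals e' f' k j = 0 := by
  simp [Fin.sum_univ_three, oppositeNormals]

lemma sum_chordNormals (f' : Plane) : ∑ j, chordNormals f' j = 0 := by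
  simp [Fin.sum_univ_three, chordNormals]

/-! ### Lower bound and attainment of the capacity -/

/-- Every closed characteristic has at least the action `c`. -/
lemma IsClosedCharacteristic.le_loopAction {T : Set Plane} {a e f e' f' : Plane} {c k : ℝ}
    (hc : 0 < c) (hT : IsConvexBody T) (hT0 : T ∈ nhds (0 : Plane))
    (hA0 : frameRegion a e' f' k ∈ nhds (0 : Plane)) (hfr : IsDualFrame e f e' f')
    (h1 : HasTriangle T c (chordNormals f')) (h2 : HasTriangle T c (triangleNormals e' f' k))
    (h3 : HasTriangle T c (oppositeNormals e' f' k)) {x : ℝ → PhaseSpace}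
    (hx : IsClosedCharacteristic (frameRegion a e' f' k ×ˢ T) x) : c ≤ loopAction x := by
  have hv := hx.ae_velocity (isClosed_frameRegion a e' f' k) hT.isCompact.isClosed hA0 hT0
    (convex_frameRegion a e' f' k) hT.convex
  have hac := hx.absolutelyContinuous
  have hd : ∀ᵐ t, t ∈ uIcc (0 : ℝ) 1 → DifferentiableAt ℝ x t := by
    rw [uIcc_of_le zero_le_one]
    filter_upwards [hv] with t ht hm using (ht hm).1
  have hneg : ∀ᵐ t, t ∈ Icc (0 : ℝ) 1 → phaseInner (sympJ (deriv x t)) (x t) < 0 := by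
    filter_upwards [hv] with t ht hm using (ht hm).2.1
  have hB : ∀ᵐ t, t ∈ Icc (0 : ℝ) 1 →
      ∀ y ∈ T, inner ℝ (deriv x t).1 y ≤ inner ℝ (deriv x t).1 (x t).2 := by
    filter_upwards [hv] with t ht hm using (ht hm).2.2.1
  have hA : ∀ᵐ t, t ∈ Icc (0 : ℝ) 1 → ∀ y ∈ frameRegion a e' f' k,
      inner ℝ (deriv x t).2 (x t).1 ≤ inner ℝ (deriv x t).2 y := by
    filter_upwards [hv] with t ht hm using (ht hm).2.2.2
  have hpos := loopAction_pos hac hd hneg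
  have hbound : BoundsTriangles (ι := Icc (0 : ℝ) 1) T (fun t => (x t).1) (loopAction x) :=
    fun y hy i₀ i₁ i₂ h₀₁ h₁₂ =>
      sum_inner_le_loopAction hac hd hx.closed hB hy i₀.2.1 h₀₁ h₁₂ i₂.2.2
  have hcont : ContinuousOn x (Icc 0 1) := by
    have := hac.continuousOn
    rwa [uIcc_of_le zero_le_one] at this
  have hmin : ∀ u : Plane, ∃ i : Icc (0 : ℝ) 1, ∀ l : Icc (0 : ℝ) 1,
      inner ℝ u (x i).1 ≤ inner ℝ u (x l).1 := by
    intro u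
    obtain ⟨i, hi, hmin⟩ := isCompact_Icc.exists_isMinOn (nonempty_Icc.2 zero_le_one)
      (f := fun t => inner ℝ u (x t).1) (by fun_prop)
    exact ⟨⟨i, hi⟩, fun l => hmin l.2⟩
  obtain ⟨i, hi⟩ := hmin e'
  obtain ⟨j, hj⟩ := hmin f'
  obtain ⟨v, hv⟩ := hbound.exists_translate hpos hc (a := a) hfr h1 h2 h3 hi hj
  have := one_le_of_translate_mem_smul hac hd hx.closed hneg hA (div_pos hpos hc).le
    (v := v) (fun t ht => hv ⟨t, ht⟩)
  rwa [one_le_div hc] at this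

/-- A largest triangle in `T` with the given normals as edges that is not larger than the other ones
comes from a closed characteristic. -/
lemma mem_actionSpectrum_of_dual {T : Set Plane} {a e f e' f' : Plane} {c k : ℝ}
    (hc : 0 < c) (hT : IsConvexBody T) (hT0 : T ∈ nhds (0 : Plane))
    (hA0 : frameRegion a e' f' k ∈ nhds (0 : Plane)) (hfr : IsDualFrame e f e' f')
    (h1 : HasTriangle T c (chordNormals f')) (h2 : HasTriangle T c (triangleNormals e' f' k))
    (h3 : HasTriangle T c (oppositeNormals e' f' k)) {d : Fin 3 → Plane} {η : Fin 3 → ℝ}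
    (hsum : ∑ j, d j = 0) (hη : ∑ j, η j = 1)
    (hdη : ∀ j, ∀ y ∈ frameRegion a e' f' k, inner ℝ (d j) (y - a) ≤ η j)
    {p q : Fin 3 → Plane} (hp : ∀ j, p j ∈ T) (hpd : ∀ j, p j - p (j + 1) = c • d (j + 1))
    (hdq : ∑ j, inner ℝ (d j) (q j) = 1)
    (hqp : ∀ j, ∀ y ∈ T, inner ℝ (q (j + 1) - q j) y ≤ inner ℝ (q (j + 1) - q j) (p j)) :
    c ∈ actionSpectrum (frameRegion a e' f' k ×ˢ T) := by
  have hlen : ∑ j, inner ℝ (q (j + 1) - q j) (p j) = c := by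
    have e0 := congrArg (fun z => inner ℝ z (q 0)) (show p 2 - p 0 = c • d 0 from hpd 2)
    have e1 := congrArg (fun z => inner ℝ z (q 1)) (show p 0 - p 1 = c • d 1 from hpd 0)
    have e2 := congrArg (fun z => inner ℝ z (q 2)) (show p 1 - p 2 = c • d 2 from hpd 1)
    rw [Fin.sum_univ_three] at hdq ⊢
    simp only [Fin.isValue, zero_add, show (1 + 1 : Fin 3) = 2 from rfl,
      show (2 + 1 : Fin 3) = 0 from rfl, inner_sub_left, real_inner_smul_left,
      real_inner_comm (p _) (q _)] at *
    linear_combination e0 + e1 + e2 + c * hdq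
  -- An increasing triple of indices gives `q` itself or a degenerate triangle, which the triangle
  -- inequality for the `T`-length controls.
  have hbound : BoundsTriangles T q c := by
    intro y hy i₀ i₁ i₂ h₀₁ h₁₂
    have a0 := fun l => hqp 0 (y l) (hy l)
    have a1 := fun l => hqp 1 (y l) (hy l)
    have a2 := fun l => hqp 2 (y l) (hy l)
    rw [Fin.sum_univ_three] at hlen
    simp only [Fin.isValue, zero_add, show (1 + 1 : Fin 3) = 2 from rfl,
      show (2 + 1 : Fin 3) = 0 from rfl, inner_sub_left] at *
    have := a0 0; have := a0 1; have := a0 2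
    have := a1 0; have := a1 1; have := a1 2
    have := a2 0; have := a2 1; have := a2 2
    fin_cases i₀ <;> fin_cases i₁ <;> fin_cases i₂ <;> simp at h₀₁ h₁₂ ⊢ <;> linarith
  obtain ⟨i, hi⟩ := Finite.exists_min fun j => inner ℝ e' (q j)
  obtain ⟨j, hj⟩ := Finite.exists_min fun j => inner ℝ f' (q j)
  obtain ⟨v, hv⟩ := hbound.exists_translate hc hc (a := a) hfr h1 h2 h3 hi hj
  rw [div_self hc.ne'] at hv
  have hmem : ∀ j, q j + v ∈ frameRegion a e' f' k := fun j => by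
    obtain ⟨y, hy, h⟩ := hv j
    rw [h, one_smul]; exact hy
  have hle : ∀ j ∈ Finset.univ, inner ℝ (d j) (q j + v - a) ≤ η j := fun j _ => hdη j _ (hmem j)
  have hsum' : ∑ j, inner ℝ (d j) (q j + v - a) = ∑ j, η j := by
    simp only [add_sub_assoc, inner_add_right, Finset.sum_add_distrib]
    rw [← sum_inner, hsum, hdq, hη, inner_zero_left, add_zero]
  -- The translated triangle satisfies each side inequality and their sum is an equality, so each
  -- vertex lies on its side and `d j` is normal there.
  have heq : ∀ j, inner ℝ (d j) (q j + v - a) = η j := fun j =>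
    (Finset.sum_eq_sum_iff_of_le hle).1 hsum' j (Finset.mem_univ j)
  rw [← hlen]
  have := mem_actionSpectrum_of_triangles (q := fun j => q j + v) (p := p) hA0 hT0
    (convex_frameRegion a e' f' k) hT.convex hmem hp
    (fun j y hy => by simpa using hqp j y hy)
    (fun j y hy => by
      rw [hpd, real_inner_smul_left, real_inner_smul_left]
      refine mul_le_mul_of_nonneg_left ?_ hc.le
      have := hdη (j + 1) y hy
      rw [← heq, inner_sub_right, inner_sub_right] at this
      linarith)
    (by simpa [hlen] using hc)
  simpa using this

/-! ### Areas of the two factors and conclusion -/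

lemma volume_frameRegion_ge {a e f e' f' : Plane} {k : ℝ} (hk1 : k ≤ 1)
    (hfr : IsDualFrame e f e' f') :
    ENNReal.ofReal ((2 - k) / 2) ≤
      ENNReal.ofReal |f' 0 * e' 1 - f' 1 * e' 0| * volume (frameRegion a e' f' k) := by
  rw [← volume_image_inner_pair]
  set F : Plane → ℝ × ℝ := fun p => (inner ℝ f' p, inner ℝ e' p) with hF
  have hconv : Convex ℝ (F '' frameRegion a e' f' k) :=
    (convex_frameRegion a e' f' k).is_linear_image
      ⟨fun x y => by simp [hF, inner_add_right], fun r x => by simp [hF, inner_smul_right]⟩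
  obtain ⟨ee, ef, fe, ff⟩ := hfr
  have h1 : HasChord (F '' frameRegion a e' f' k) (inner ℝ f' a) 1 :=
    ⟨inner ℝ e' a, ⟨a, by simp [frameRegion], rfl⟩,
      ⟨a + e, by simp [frameRegion, ee, fe], by simp [hF, inner_add_right, ee, fe]⟩⟩
  have h2 : HasChord (F '' frameRegion a e' f' k) (inner ℝ f' a + 1) (1 - k) :=
    ⟨inner ℝ e' a, ⟨a + f, by simp [frameRegion, ef, ff, hk1],
      by simp [hF, inner_add_right, ef, ff]⟩,
      ⟨a + (f + (1 - k) • e), by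
        simp [frameRegion, inner_add_right, inner_smul_right, ee, ef, fe, ff, hk1],
        by simp [hF, inner_add_right, inner_smul_right, ee, ef, fe, ff]⟩⟩
  refine le_trans (le_trans (ENNReal.ofReal_le_ofReal ?_)
    (volume_strip_ge hconv (by linarith) zero_le_one (by linarith) h1 h2))
    (measure_mono inter_subset_left)
  linarith

/-- Pairing with `e` and `f` makes `e'` horizontal and `f'` vertical of unit length. The triple of
`chordNormals` becomes the vertical chord, the other two become the opposite triangles. -/
lemma volume_ge_of_hasTriangle {T : Set Plane} {e f e' f' : Plane} {c k : ℝ} (hc : 0 < c)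
    (hk : 0 ≤ k) (hk1 : k ≤ 1) (hT : IsConvexBody T) (hfr : IsDualFrame e f e' f')
    (h1 : HasTriangle T c (chordNormals f')) (h2 : HasTriangle T c (triangleNormals e' f' k))
    (h3 : HasTriangle T c (oppositeNormals e' f' k)) :
    ENNReal.ofReal (c ^ 2 / (2 - k)) ≤
      ENNReal.ofReal |e 0 * f 1 - e 1 * f 0| * volume T := by
  rw [← volume_image_inner_pair]
  set F : Plane → ℝ × ℝ := fun p => (inner ℝ e p, inner ℝ f p) with hF
  have hconv : Convex ℝ (F '' T) :=
    hT.convex.is_linear_image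
      ⟨fun x y => by simp [hF, inner_add_right], fun r x => by simp [hF, inner_smul_right]⟩
  have hmeas : MeasurableSet (F '' T) :=
    (hT.isCompact.image (by fun_prop)).measurableSet
  obtain ⟨ee, ef, fe, ff⟩ := hfr
  rw [real_inner_comm] at ee ef fe ff
  obtain ⟨u, hu, hud⟩ := h1
  obtain ⟨v, hv, hvd⟩ := h2
  obtain ⟨w, hw, hwd⟩ := h3
  have u2 : u 2 = u 0 + c • f' := by
    rw [← sub_eq_iff_eq_add']; exact hud 2
  have v1 : v 1 = v 0 + c • e' := by
    have : v 0 - v 1 = c • -e' := hvd 0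
    rw [smul_neg, ← neg_sub, neg_inj] at this
    rw [← this]; abel
  have v2 : v 2 = v 0 + c • e' + (c * k) • f' := by
    have : v 1 - v 2 = c • -(k • f') := hvd 1
    rw [smul_neg, ← neg_sub, neg_inj, smul_smul] at this
    rw [← this, ← v1]; abel
  have w1 : w 1 = w 0 + (c * k) • f' := by
    have : w 0 - w 1 = c • -(k • f') := hwd 0
    rw [smul_neg, ← neg_sub, neg_inj, smul_smul] at this
    rw [← this]; abel
  have w2 : w 2 = w 0 + (c * k) • f' + c • e' := by
    have : w 1 - w 2 = c • -e' := hwd 1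
    rw [smul_neg, ← neg_sub, neg_inj] at this
    rw [← this, ← w1]; abel
  refine volume_ge_of_triangles hconv hmeas (α := inner ℝ e (w 0)) (β := inner ℝ e (v 0))
    (x₀ := inner ℝ e (u 0)) hc hk hk1 ?_ ?_ ?_ ?_ ?_
  · exact ⟨inner ℝ f (w 0), ⟨w 0, hw 0, rfl⟩, ⟨w 1, hw 1, by
      simp [hF, w1, inner_add_right, inner_smul_right, fe, ff]⟩⟩
  · have : F (w 2) = (inner ℝ e (w 0) + c, inner ℝ f (w 0) + c * k) := by
      simp [hF, w2, inner_add_right, inner_smul_right, ee, ef, fe, ff]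
    exact ⟨inner ℝ f (w 0) + c * k, ⟨w 2, hw 2, this⟩, ⟨w 2, hw 2, by rw [this, add_zero]⟩⟩
  · exact ⟨inner ℝ f (v 0), ⟨v 0, hv 0, rfl⟩, ⟨v 0, hv 0, by simp [hF]⟩⟩
  · exact ⟨inner ℝ f (v 0), ⟨v 1, hv 1, by
      simp [hF, v1, inner_add_right, inner_smul_right, ee, ef]⟩, ⟨v 2, hv 2, by
      simp [hF, v2, inner_add_right, inner_smul_right, ee, ef, fe, ff]⟩⟩
  · exact ⟨inner ℝ f (u 0), ⟨u 0, hu 0, rfl⟩, ⟨u 2, hu 2, by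
      simp [hF, u2, inner_add_right, inner_smul_right, fe, ff]⟩⟩

/-- The capacity of the product of a trapezoid and a convex body, with its volume bound. -/
lemma exists_isLeast_actionSpectrum {T : Set Plane} {a e f e' f' : Plane} {k : ℝ}
    (hk : 0 ≤ k) (hk1 : k ≤ 1) (hT : IsConvexBody T) (hT0 : T ∈ nhds (0 : Plane))
    (hA0 : frameRegion a e' f' k ∈ nhds (0 : Plane)) (hfr : IsDualFrame e f e' f')
    (hdet : |f' 0 * e' 1 - f' 1 * e' 0| * |e 0 * f 1 - e 1 * f 0| = 1) :
    ∃ c : ℝ, IsLeast (actionSpectrum (frameRegion a e' f' k ×ˢ T)) c ∧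
      ENNReal.ofReal (c ^ 2 / 2) ≤ volume (frameRegion a e' f' k ×ˢ T) := by
  have hne : ∀ d : Fin 3 → Plane, (∃ u, inner ℝ (d 0) u = 1) → d ≠ 0 := by
    rintro d ⟨u, hu⟩ rfl
    simp at hu
  have hne₀ : inner ℝ (e' + k • f') e = (1 : ℝ) := by
    rw [inner_add_left, real_inner_smul_left, hfr.ee, hfr.fe, mul_zero, add_zero]
  obtain ⟨s₁, hs₁, p₁, q₁, hp₁, hpd₁, hdq₁, hqp₁⟩ := exists_dual_triangles hT
    (sum_chordNormals f') (hne _ ⟨f, hfr.ff⟩)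
  obtain ⟨s₂, hs₂, p₂, q₂, hp₂, hpd₂, hdq₂, hqp₂⟩ := exists_dual_triangles hT
    (sum_triangleNormals e' f' k) (hne _ ⟨e, hne₀⟩)
  obtain ⟨s₃, hs₃, p₃, q₃, hp₃, hpd₃, hdq₃, hqp₃⟩ := exists_dual_triangles hT
    (sum_oppositeNormals e' f' k) (hne _ ⟨e, hne₀⟩)
  -- All three triangles shrink to the size `c`; the triple that realizes the minimum supplies the
  -- minimizing characteristic.
  obtain ⟨c, hc, hc₁, hc₂, hc₃, hcases⟩ : ∃ c, 0 < c ∧ c ≤ s₁ ∧ c ≤ s₂ ∧ c ≤ s₃ ∧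
      (s₁ = c ∨ s₂ = c ∨ s₃ = c) := by
    refine ⟨min s₁ (min s₂ s₃), by positivity, by simp, by simp, by simp, ?_⟩
    rcases min_choice s₁ (min s₂ s₃) with h | h
    · exact Or.inl h.symm
    · rw [h]
      rcases min_choice s₂ s₃ with h | h <;> simp [h]
  have h1 : HasTriangle T c (chordNormals f') :=
    HasTriangle.mono hT.convex ⟨p₁, hp₁, hpd₁⟩ hc hc₁
  have h2 : HasTriangle T c (triangleNormals e' f' k) :=
    HasTriangle.mono hT.convex ⟨p₂, hp₂, hpd₂⟩ hc hc₂
  have h3 : HasTriangle T c (oppositeNormals e' f' k) :=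
    HasTriangle.mono hT.convex ⟨p₃, hp₃, hpd₃⟩ hc hc₃
  refine ⟨c, ⟨?_, ?_⟩, ?_⟩
  · rcases hcases with rfl | rfl | rfl
    -- Support values relative to the corner `a`: the sides through `a` have value `0`, the side
    -- opposite to it has value `1`.
    · refine mem_actionSpectrum_of_dual hc hT hT0 hA0 hfr h1 h2 h3 (η := ![1, 0, 0])
        (sum_chordNormals f') (by simp [Fin.sum_univ_three]) ?_ hp₁ hpd₁ hdq₁ hqp₁
      rintro j y ⟨y1, y2, y3, y4⟩
      fin_cases j <;> simp [chordNormals, y1, y2]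
    · refine mem_actionSpectrum_of_dual hc hT hT0 hA0 hfr h1 h2 h3 (η := ![1, 0, 0])
        (sum_triangleNormals e' f' k) (by simp [Fin.sum_univ_three]) ?_ hp₂ hpd₂ hdq₂ hqp₂
      rintro j y ⟨y1, y2, y3, y4⟩
      fin_cases j <;> simp [triangleNormals, inner_add_left, real_inner_smul_left, y3, y4,
        mul_nonneg hk y1]
    · refine mem_actionSpectrum_of_dual hc hT hT0 hA0 hfr h1 h2 h3 (η := ![1, 0, 0])
        (sum_oppositeNormals e' f' k) (by simp [Fin.sum_univ_three]) ?_ hp₃ hpd₃ hdq₃ hqp₃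
      rintro j y ⟨y1, y2, y3, y4⟩
      fin_cases j <;> simp [oppositeNormals, inner_add_left, real_inner_smul_left, y3, y4,
        mul_nonneg hk y1]
  · rintro _ ⟨x, hx, rfl⟩
    exact hx.le_loopAction hc hT hT0 hA0 hfr h1 h2 h3
  · have hA := volume_frameRegion_ge (a := a) hk1 hfr
    have hB := volume_ge_of_hasTriangle hc hk hk1 hT hfr h1 h2 h3
    have h2k : 0 < 2 - k := by linarith
    calc ENNReal.ofReal (c ^ 2 / 2)
        = ENNReal.ofReal ((2 - k) / 2) * ENNReal.ofReal (c ^ 2 / (2 - k)) := by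
          rw [← ENNReal.ofReal_mul (by positivity)]
          congr 1
          field_simp
      _ ≤ _ := mul_le_mul' hA hB
      _ = volume (frameRegion a e' f' k ×ˢ T) := by
          rw [mul_mul_mul_comm, ← ENNReal.ofReal_mul (abs_nonneg _), hdet, ENNReal.ofReal_one,
            one_mul, Measure.volume_eq_prod, Measure.prod_prod]

theorem theorem1p1 (Q T : Set Plane) (hQ : IsTrapezoid Q) (hT : IsConvexBody T)
    (z₀ : PhaseSpace) (hz₀ : z₀ ∈ interior (Q ×ˢ T)) :
    IsLeast (actionSpectrum ((fun z => z - z₀) '' (Q ×ˢ T)))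
        (cEHZ ((fun z => z - z₀) '' (Q ×ˢ T))) ∧
      (volume : Measure PhaseSpace).real (Q ×ˢ T) ≥
        cEHZ ((fun z => z - z₀) '' (Q ×ˢ T)) ^ 2 / 2 := by
  have hQc : IsCompact Q := by
    obtain ⟨a, b, c, d, -, -, rfl⟩ := hQ
    exact (Set.toFinite _).isCompact_convexHull ℝ
  obtain ⟨a, e, f, e', f', k, hk, hk1, hfr, hdet, rfl⟩ := hQ.exists_frame
  obtain ⟨q₀, p₀⟩ := z₀
  rw [interior_prod_eq] at hz₀
  have hnhds : ∀ {S : Set Plane} {p : Plane}, p ∈ interior S →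
      (fun q => q - p) '' S ∈ nhds (0 : Plane) := by
    intro S p hp
    have := (Homeomorph.subRight p).isOpenMap.image_mem_nhds (mem_interior_iff_mem_nhds.1 hp)
    simpa using this
  have himage : (fun z : PhaseSpace => z - (q₀, p₀)) '' (frameRegion a e' f' k ×ˢ T) =
      frameRegion (a - q₀) e' f' k ×ˢ ((fun p => p - p₀) '' T) := by
    rw [← image_sub_frameRegion, prod_image_image_eq]
    rfl
  have hT0 := hnhds hz₀.2
  have hT' : IsConvexBody ((fun p => p - p₀) '' T) :=
    ⟨hT.isCompact.image (by fun_prop), by simpa [sub_eq_add_neg, add_comm] using hT.convex.translate (-p₀),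
      ⟨0, mem_interior_iff_mem_nhds.2 hT0⟩⟩
  have hA0 := hnhds hz₀.1
  rw [image_sub_frameRegion] at hA0
  obtain ⟨c, hc, hvol⟩ := exists_isLeast_actionSpectrum hk hk1 hT' hT0 hA0 hfr hdet
  rw [← himage] at hc hvol
  have hcE : cEHZ ((fun z : PhaseSpace => z - (q₀, p₀)) '' (frameRegion a e' f' k ×ˢ T)) = c :=
    hc.csInf_eq
  rw [hcE]
  refine ⟨hc, ?_⟩
  have hv : volume ((fun z : PhaseSpace => z - (q₀, p₀)) '' (frameRegion a e' f' k ×ˢ T)) =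
      volume (frameRegion a e' f' k ×ˢ T) := by
    simp only [sub_eq_add_neg, image_add_right, Measure.volume_eq_prod]
    exact measure_preimage_add_right _ _ _
  rw [hv] at hvol
  exact (ENNReal.ofReal_le_iff_le_toReal (hQc.prod hT.isCompact).measure_lt_top.ne).1 hvol
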